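/- Notation. For a symmetric positive semidefinite kernel $K$ on a set $X$ let $\mathcal H(K)$ be its (real) reproducing kernel Hilbert space, with norm $\|\cdot\|_K$. Write $\mathcal H(K_1)\hookrightarrow\mathcal H(K_2)$ if $\mathcal H(K_1)\subseteq\mathcal H(K_2)$ as sets of functions and there is $C>0$ with $\|f\|_{K_2}\le C\|f\|_{K_1}$ for all $f\in\mathcal H(K_1)$; write $\mathcal H(K_1)\leftrightharpoons\mathcal H(K_2)$ if embeddings hold in both directions, and $\mathcal H(K_1)\not\subset\mathcal H(K_2)$ if some function in $\mathcal H(K_1)$ is not in $\mathcal H(K_2)$. For $\gamma>0$ and real $\alpha>1/2$ put $r_{\alpha,\gamma}(0)=1$ and $r_{\alpha,\gamma}(h)=\gamma|h|^{-2\alpha}$ for $h\in\mathbb Z\setminus\{0\}$, and define on $[0,1]$ the kernels $$K^{\rm kor}_{\alpha,\gamma}(x,y)=\sum_{h\in\mathbb Z}r_{\alpha,\gamma}(h)\,e^{2\pi i h(x-y)},\qquad K^{\cos}_{\alpha,\gamma}(x,y)=1+\sum_{k=1}^\infty r_{\alpha,\gamma}(k)\,\sqrt2\cos(\pi kx)\,\sqrt2\cos(\pi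 ky),$$ $$K^{\rm kor+\cos}_{\alpha,\gamma}=\tfrac12\bigl(K^{\rm kor}_{\alpha,\gamma}+K^{\cos}_{\alpha,\gamma}\bigr)$$ and, for integers $\alpha\ge1$, with $B_\tau$ the Bernoulli polynomials, $$K^{\rm sob}_{\alpha,\gamma}(x,y)=1+\gamma\sum_{\tau=1}^{\alpha}\frac{B_\tau(x)B_\tau(y)}{(\tau!)^2}-(-1)^\alpha\gamma\,\frac{B_{2\alpha}(|x-y|)}{(2\alpha)!}.$$ For $s\ge1$, $\boldsymbol\gamma=(\gamma_1,\dots,\gamma_s)$ with all $\gamma_j>0$, and $*\in\{{\rm kor},\cos,{\rm kor+cos},{\rm sob}\}$, let $K^{*}_{\alpha,\boldsymbol\gamma,s}(\boldsymbol x,\boldsymbol y)=\prod_{j=1}^sK^{*}_{\alpha,\gamma_j}(x_j,y_j)$ on $[0,1]^s$ and $H^{*}_\alpha=\mathcal H(K^{*}_{\alpha,\boldsymbol\gamma,s})$ (the Korobov, half-period cosine, sum, and unanchored Sobolev space). Theorem. Let $s\ge1$ and $\boldsymbol\gamma\in(0,\infty)^s$. (1) For $\alpha=1$: $H^{\rm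 kor}_1\hookrightarrow H^{\rm sob}_1\leftrightharpoons H^{\cos}_1\leftrightharpoons H^{\rm kor+cos}_1$ (so the last three are mutually equivalent), and none of $H^{\rm sob}_1$, $H^{\cos}_1$, $H^{\rm kor+cos}_1$ is contained in $H^{\rm kor}_1$. (2) For every integer $\alpha>1$: $H^{\rm kor}_\alpha\hookrightarrow H^{\rm kor+cos}_\alpha$, $H^{\cos}_\alpha\hookrightarrow H^{\rm kor+cos}_\alpha$ and $H^{\rm kor+cos}_\alpha\hookrightarrow H^{\rm sob}_\alpha$. (3) For every real $\alpha>1/2$: $H^{\cos}_\alpha\not\subset H^{\rm kor}_\alpha$ and $H^{\rm kor+cos}_\alpha\not\subset H^{\rm kor}_\alpha$; if moreover $\alpha\ge3/2$, then $H^{\rm kor+cos}_\alpha\not\subset H^{\cos}_\alpha$ and $H^{\rm kor}_\alpha\not\subset H^{\cos}_\alpha$. -/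

import Mathlib

noncomputable section

namespace RKSpaces

open Real

/-! ### Positive semidefinite kernels: elementary facts -/

/-- Positive semidefiniteness of a real kernel on an arbitrary set, in terms of finite sums. -/
theorem posSemidef_iff_sum {X : Type*} (K : Matrix X X ℝ) :
    K.PosSemidef ↔ (∀ x y, K x y = K y x) ∧
      ∀ (t : Finset X) (c : X → ℝ), 0 ≤ ∑ x ∈ t, ∑ y ∈ t, c x * K x y * c y := by
  classical
  constructor
  · intro h
    refine ⟨fun x y => ?_, fun t c => ?_⟩
    · simpa using (h.1.apply x y).symm
    · have := h.2 (Finsupp.onFinset t (fun x => if x ∈ t then c x else 0)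
        fun a ha => by by_contra hn; simp [hn] at ha)
      rw [Finsupp.onFinset_sum _ (by simp)] at this
      refine this.trans_eq (Finset.sum_congr rfl fun x hx => ?_)
      rw [Finsupp.onFinset_sum _ (by simp)]
      refine Finset.sum_congr rfl fun y hy => ?_
      simp [hx, hy]
  · rintro ⟨h1, h2⟩
    refine ⟨?_, fun v => ?_⟩
    · ext x y
      simpa using h1 y x
    · simpa [Finsupp.sum] using h2 v.support v

theorem posSemidef_const_one {X : Type*} : (Matrix.of fun _ _ : X => (1 : ℝ)).PosSemidef := by
  rw [posSemidef_iff_sum]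
  refine ⟨fun _ _ => rfl, fun t c => ?_⟩
  have : ∑ x ∈ t, ∑ y ∈ t, c x * (1 : ℝ) * c y = (∑ x ∈ t, c x) ^ 2 := by
    rw [sq, Finset.sum_mul_sum]; simp
  simp only [Matrix.of_apply, this]
  exact sq_nonneg _

theorem posSemidef_rankOne {X : Type*} (a : ℝ) (ha : 0 ≤ a) (u : X → ℝ) :
    (Matrix.of fun x y => a * (u x * u y)).PosSemidef := by
  rw [posSemidef_iff_sum]
  refine ⟨fun x y => by simp [mul_comm], fun t c => ?_⟩
  have : ∑ x ∈ t, ∑ y ∈ t, c x * (a * (u x * u y)) * c y = a * (∑ x ∈ t, c x * u x) ^ 2 := by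
    rw [sq, Finset.sum_mul_sum, Finset.mul_sum]
    refine Finset.sum_congr rfl fun x _ => ?_
    rw [Finset.mul_sum]
    exact Finset.sum_congr rfl fun y _ => by ring
  simp only [Matrix.of_apply, this]
  exact mul_nonneg ha (sq_nonneg _)

theorem posSemidef_of_hasSum {X ι : Type*} {A : ι → Matrix X X ℝ} {K : Matrix X X ℝ}
    (hA : ∀ i, (A i).PosSemidef) (h : ∀ x y, HasSum (fun i => A i x y) (K x y)) :
    K.PosSemidef := by
  simp only [posSemidef_iff_sum] at hA ⊢
  refine ⟨fun x y => ?_, fun t c => ?_⟩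
  · exact (h x y).unique (by simpa only [(hA _).1 x y] using h y x)
  · have : HasSum (fun i => ∑ x ∈ t, ∑ y ∈ t, c x * A i x y * c y)
        (∑ x ∈ t, ∑ y ∈ t, c x * K x y * c y) :=
      hasSum_sum fun x _ => hasSum_sum fun y _ => ((h x y).mul_left _).mul_right _
    exact this.nonneg fun i => (hA i).2 t c

theorem posSemidef_mul {X : Type*} {A B : Matrix X X ℝ} (hA : A.PosSemidef) (hB : B.PosSemidef) :
    (Matrix.of fun x y => A x y * B x y).PosSemidef := by
  classical
  rw [posSemidef_iff_sum]
  refine ⟨fun x y => ?_, fun t c => ?_⟩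
  · simp [((posSemidef_iff_sum A).1 hA).1 x y, ((posSemidef_iff_sum B).1 hB).1 x y]
  · have h := (hA.submatrix (Subtype.val : t → X)).hadamard (hB.submatrix (Subtype.val : t → X))
    have := ((posSemidef_iff_sum _).1 h).2 Finset.univ (fun x => c x)
    simp only [Finset.univ_eq_attach, Matrix.hadamard_apply, Matrix.submatrix_apply] at this
    rw [← Finset.sum_attach]
    simpa only [Matrix.of_apply, ← Finset.sum_attach t (fun y => _ * c y)] using this

/-! ### Reproducing kernels and their Hilbert spaces -/

/-- A real reproducing kernel on `X`: a symmetric, positive semidefinite function of two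
variables. -/
structure RKernel (X : Type*) where
  toMatrix : Matrix X X ℝ
  posSemidef : toMatrix.PosSemidef

instance {X : Type*} : CoeFun (RKernel X) (fun _ => X → X → ℝ) := ⟨fun K => K.toMatrix⟩

/-- The kernel with its real values regarded as (multiplication) operators on `ℝ`, the form in
which Mathlib's construction of reproducing kernel Hilbert spaces takes a kernel. -/
def RKernel.op {X : Type*} (K : RKernel X) : Matrix X X (ℝ →L[ℝ] ℝ) :=
  Matrix.of fun x y => K x y • ContinuousLinearMap.id ℝ ℝ

theorem RKernel.posSemidef_op {X : Type*} (K : RKernel X) : K.op.PosSemidef := by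
  have hK := (posSemidef_iff_sum _).1 K.posSemidef
  have h := (RKHS.posSemidef_tfae (K := K.op)).out 0 2
  rw [h]
  refine ⟨?_, fun v => ?_⟩
  · ext x y
    have e : star (ContinuousLinearMap.id ℝ ℝ) = ContinuousLinearMap.id ℝ ℝ :=
      star_one (ℝ →L[ℝ] ℝ)
    simp [RKernel.op, hK.1 x y, e]
  · refine (hK.2 v.support v).trans_eq ?_
    simp only [Finsupp.sum, map_sum]
    refine Finset.sum_congr rfl fun x _ => Finset.sum_congr rfl fun y _ => ?_
    simp [RKernel.op, hK.1 x y]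
    ring

instance {X : Type*} (K : RKernel X) : Fact K.op.PosSemidef := ⟨K.posSemidef_op⟩

/-- The reproducing kernel Hilbert space `H(K)`. -/
abbrev RKernel.Space {X : Type*} (K : RKernel X) : Type _ := RKHS.OfKernel K.op

/-- The set of functions on `X` which belong to `H(K)`. -/
def RKernel.functions {X : Type*} (K : RKernel X) : Set (X → ℝ) :=
  Set.range fun f : K.Space => (f : X → ℝ)

/-- `H(K₁) ↪ H(K₂)`: as sets of functions `H(K₁) ⊆ H(K₂)`, and there is a constant `C > 0` with
`‖f‖_{K₂} ≤ C ‖f‖_{K₁}` for every function `f` in `H(K₁)`. -/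
def RKernel.ContEmbedded {X : Type*} (K₁ K₂ : RKernel X) : Prop :=
  K₁.functions ⊆ K₂.functions ∧
    ∃ C : ℝ, 0 < C ∧ ∀ (f₁ : K₁.Space) (f₂ : K₂.Space),
      (f₁ : X → ℝ) = (f₂ : X → ℝ) → ‖f₂‖ ≤ C * ‖f₁‖

/-- `H(K₁) ⇌ H(K₂)`: continuous embeddings in both directions. -/
def RKernel.Equivalent {X : Type*} (K₁ K₂ : RKernel X) : Prop :=
  K₁.ContEmbedded K₂ ∧ K₂.ContEmbedded K₁

/-- The mean of two kernels, `(K₁ + K₂) / 2`. -/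
def RKernel.half {X : Type*} (K₁ K₂ : RKernel X) : RKernel X where
  toMatrix := Matrix.of fun x y => 1 / 2 * (K₁ x y + K₂ x y)
  posSemidef := (K₁.posSemidef.add K₂.posSemidef).smul (by norm_num : (0 : ℝ) ≤ 1 / 2)

/-- The product kernel `∏ⱼ Kⱼ(xⱼ, yⱼ)`, which is the kernel of the tensor product space. -/
def RKernel.pi {X : Type*} {s : ℕ} (K : Fin s → RKernel X) : RKernel (Fin s → X) where
  toMatrix := Matrix.of fun x y => ∏ j, K j (x j) (y j)
  posSemidef := by
    have key : ∀ t : Finset (Fin s), (Matrix.of fun x y : Fin s → X =>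
        ∏ j ∈ t, K j (x j) (y j)).PosSemidef := by
      classical
      intro t
      induction t using Finset.induction_on with
      | empty => simpa using posSemidef_const_one
      | insert j t hj ih =>
        simp only [Finset.prod_insert hj]
        exact posSemidef_mul ((K j).posSemidef.submatrix fun x : Fin s → X => x j) ih
    exact key Finset.univ

/-! ### The kernels on `[0,1]` -/

/-- The weight `r_{α,γ}(h)`: `1` for `h = 0` and `γ |h|^{-2α}` otherwise. -/
def weight (α γ : ℝ) (h : ℤ) : ℝ := if h = 0 then 1 else γ * |(h : ℝ)| ^ (-2 * α)

theorem weight_nonneg (α : ℝ) {γ : ℝ} (hγ : 0 < γ) (h : ℤ) : 0 ≤ weight α γ h := by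
  unfold weight; split_ifs <;> positivity

theorem summable_weight {α : ℝ} (hα : 1 / 2 < α) (γ : ℝ) : Summable (weight α γ) := by
  have h0 : Summable fun h : ℤ => γ * |(h : ℝ)| ^ (-2 * α) := by
    have := (Real.summable_abs_int_rpow (b := 2 * α) (by linarith)).mul_left γ
    simpa [neg_mul] using this
  refine (summable_congr_cofinite ?_).2 h0
  filter_upwards [(Set.finite_singleton (0 : ℤ)).compl_mem_cofinite] with h hh
  simp only [Set.mem_compl_iff, Set.mem_singleton_iff] at hh
  simp [weight, hh]

/-- The kernel `∑_{h ∈ ℤ} r_{α,γ}(h) e^{2πih(x-y)}`; it is real-valued, since the terms for `h`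
and `-h` are conjugate. -/
def korFun (α γ : ℝ) (x y : ℝ) : ℝ :=
  (∑' h : ℤ, (weight α γ h : ℂ) * Complex.exp (2 * π * Complex.I * h * (x - y))).re

/-- The kernel `1 + ∑_{k ≥ 1} r_{α,γ}(k) √2 cos(πkx) √2 cos(πky)`. -/
def cosFun (α γ : ℝ) (x y : ℝ) : ℝ :=
  1 + ∑' k : ℕ, weight α γ ((k : ℤ) + 1) * (√2 * cos (π * ((k : ℝ) + 1) * x)) *
    (√2 * cos (π * ((k : ℝ) + 1) * y))

/-- The kernel `1 + γ ∑_{τ=1}^α B_τ(x) B_τ(y) / (τ!)² - (-1)^α γ B_{2α}(|x-y|) / (2α)!`, where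
`B_τ` is the Bernoulli polynomial of degree `τ`. -/
def sobFun (α : ℕ) (γ : ℝ) (x y : ℝ) : ℝ :=
  1 + γ * ∑ τ ∈ Finset.Icc 1 α, bernoulliFun τ x * bernoulliFun τ y / (τ.factorial : ℝ) ^ 2
    - (-1) ^ α * γ * (bernoulliFun (2 * α) |x - y| / ((2 * α).factorial : ℝ))

theorem hasSum_korFun {α : ℝ} (hα : 1 / 2 < α) {γ : ℝ} (hγ : 0 < γ) (x y : ℝ) :
    HasSum (fun h : ℤ => weight α γ h * cos (2 * π * h * (x - y))) (korFun α γ x y) := by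
  have hs : Summable fun h : ℤ =>
      (weight α γ h : ℂ) * Complex.exp (2 * π * Complex.I * h * (x - y)) := by
    refine Summable.of_norm_bounded (summable_weight hα γ) fun h => ?_
    have : (2 * π * Complex.I * h * (x - y) : ℂ) = ((2 * π * h * (x - y) : ℝ) : ℂ) * Complex.I := by
      push_cast; ring
    rw [this, norm_mul, Complex.norm_exp_ofReal_mul_I, mul_one, Complex.norm_real,
      Real.norm_of_nonneg (weight_nonneg α hγ h)]
  have := Complex.hasSum_re hs.hasSum
  refine this.congr_fun fun h => ?_
  have : (2 * π * Complex.I * h * (x - y) : ℂ) = ((2 * π * h * (x - y) : ℝ) : ℂ) * Complex.I := by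
    push_cast; ring
  rw [this, Complex.re_ofReal_mul, Complex.exp_ofReal_mul_I_re]

theorem posSemidef_cos_sub {X : Type*} {a : ℝ} (ha : 0 ≤ a) (b : ℝ) (u : X → ℝ) :
    (Matrix.of fun x y => a * cos (b * (u x - u y))).PosSemidef := by
  have h := (posSemidef_rankOne a ha fun x => cos (b * u x)).add
    (posSemidef_rankOne a ha fun x => sin (b * u x))
  convert h using 1
  ext x y
  simp only [Matrix.of_apply, Matrix.add_apply, mul_sub, cos_sub]
  ring

/-- The kernel of the Korobov space on `[0,1]`. -/
def kor (α : ℝ) (hα : 1 / 2 < α) (γ : ℝ) (hγ : 0 < γ) : RKernel (Set.Icc (0 : ℝ) 1) where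
  toMatrix := Matrix.of fun x y => korFun α γ x y
  posSemidef := posSemidef_of_hasSum
    (fun h => posSemidef_cos_sub (weight_nonneg α hγ h) (2 * π * h) Subtype.val)
    fun x y => hasSum_korFun hα hγ x y

/-- The kernel of the half-period cosine space on `[0,1]`. -/
def cosine (α : ℝ) (hα : 1 / 2 < α) (γ : ℝ) (hγ : 0 < γ) : RKernel (Set.Icc (0 : ℝ) 1) where
  toMatrix := Matrix.of fun x y => cosFun α γ x y
  posSemidef := by
    refine posSemidef_const_one.add (posSemidef_of_hasSum (ι := ℕ)
      (A := fun k => Matrix.of fun x y : Set.Icc (0 : ℝ) 1 =>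
        weight α γ ((k : ℤ) + 1) * ((√2 * cos (π * ((k : ℝ) + 1) * x)) *
          (√2 * cos (π * ((k : ℝ) + 1) * y))))
      (K := Matrix.of fun x y : Set.Icc (0 : ℝ) 1 => ∑' k : ℕ, weight α γ ((k : ℤ) + 1) *
        (√2 * cos (π * ((k : ℝ) + 1) * x)) * (√2 * cos (π * ((k : ℝ) + 1) * y)))
      (fun k => posSemidef_rankOne _ (weight_nonneg α hγ _) _) fun x y => ?_)
    simp only [Matrix.of_apply, ← mul_assoc]
    refine Summable.hasSum ?_
    have hw : Summable fun k : ℕ => weight α γ ((k : ℤ) + 1) * 2 :=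
      ((summable_weight hα γ).comp_injective
        (i := fun k : ℕ => (k : ℤ) + 1) fun a b h => by simpa using h).mul_right 2
    refine Summable.of_norm_bounded hw fun k => ?_
    have h2 : √2 * √2 = 2 := Real.mul_self_sqrt (by norm_num)
    have e : weight α γ ((k : ℤ) + 1) * √2 * cos (π * ((k : ℝ) + 1) * x) * √2 *
        cos (π * ((k : ℝ) + 1) * y) = weight α γ ((k : ℤ) + 1) * 2 *
        (cos (π * ((k : ℝ) + 1) * x) * cos (π * ((k : ℝ) + 1) * y)) := by
      linear_combination (weight α γ ((k : ℤ) + 1) * cos (π * ((k : ℝ) + 1) * x) *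
        cos (π * ((k : ℝ) + 1) * y)) * h2
    have hw0 := weight_nonneg α hγ ((k : ℤ) + 1)
    rw [e, norm_mul, Real.norm_of_nonneg (by positivity)]
    refine mul_le_of_le_one_right (by positivity) ?_
    rw [norm_mul]
    exact mul_le_one₀ (abs_cos_le_one _) (norm_nonneg _) (abs_cos_le_one _)

/-- The kernel of the sum of the Korobov and the half-period cosine space on `[0,1]`. -/
def korCos (α : ℝ) (hα : 1 / 2 < α) (γ : ℝ) (hγ : 0 < γ) : RKernel (Set.Icc (0 : ℝ) 1) :=
  (kor α hα γ hγ).half (cosine α hα γ hγ)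

/-- The kernel of the unanchored Sobolev space on `[0,1]`. -/
def sob (α : ℕ) (hα : 1 ≤ α) (γ : ℝ) (hγ : 0 < γ) : RKernel (Set.Icc (0 : ℝ) 1) where
  toMatrix := Matrix.of fun x y => sobFun α γ x y
  posSemidef := by
    have h1 : (∑ τ ∈ Finset.Icc 1 α, Matrix.of fun x y : Set.Icc (0 : ℝ) 1 =>
        γ / (τ.factorial : ℝ) ^ 2 * (bernoulliFun τ x * bernoulliFun τ y)).PosSemidef :=
      Matrix.posSemidef_sum _ fun τ _ => posSemidef_rankOne _ (by positivity) _
    have h2 : (Matrix.of fun x y : Set.Icc (0 : ℝ) 1 =>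
        -((-1) ^ α * γ * (bernoulliFun (2 * α) |(x : ℝ) - y| / ((2 * α).factorial : ℝ)))
        ).PosSemidef := by
      refine posSemidef_of_hasSum (ι := ℕ) (A := fun n => Matrix.of fun x y : Set.Icc (0 : ℝ) 1 =>
        (2 * γ / (2 * π) ^ (2 * α) * (1 / (n : ℝ) ^ (2 * α))) *
          cos (2 * π * n * ((x : ℝ) - y)))
        (fun n => posSemidef_cos_sub (by positivity) _ Subtype.val) fun x y => ?_
      have hxy : |(x : ℝ) - y| ∈ Set.Icc (0 : ℝ) 1 :=
        ⟨abs_nonneg _, abs_sub_le_iff.2 ⟨by linarith [x.2.2, y.2.1], by linarith [y.2.2, x.2.1]⟩⟩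
      have := (hasSum_one_div_nat_pow_mul_cos (k := α) (by omega) hxy).mul_left
        (2 * γ / (2 * π) ^ (2 * α))
      have hp : ((2 : ℝ) * π) ^ (2 * α) ≠ 0 := by positivity
      have hf : ((2 * α).factorial : ℝ) ≠ 0 := by positivity
      have hval : 2 * γ / (2 * π) ^ (2 * α) * ((-1 : ℝ) ^ (α + 1) * (2 * π) ^ (2 * α) / 2 /
          (2 * α).factorial * bernoulliFun (2 * α) |(x : ℝ) - y|) =
          -((-1) ^ α * γ * (bernoulliFun (2 * α) |(x : ℝ) - y| / ((2 * α).factorial : ℝ))) := by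
        rw [pow_succ]
        field_simp
      refine (hval ▸ this).congr_fun fun n => ?_
      have : cos (2 * π * n * |(x : ℝ) - y|) = cos (2 * π * n * ((x : ℝ) - y)) := by
        rcases abs_choice ((x : ℝ) - y) with h | h <;> rw [h]
        rw [mul_neg, cos_neg]
      rw [this, Matrix.of_apply, mul_assoc]
    convert (posSemidef_const_one.add h1).add h2 using 1
    ext x y
    simp only [Matrix.of_apply, Matrix.add_apply, Matrix.sum_apply, sobFun, Finset.mul_sum,
      sub_eq_add_neg]
    congr 2
    exact Finset.sum_congr rfl fun τ _ => by ring

/-! ### The kernels on `[0,1]^s` -/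

/-- The kernel `K^{kor}_{α,γ,s}`. -/
def korS (α : ℝ) (hα : 1 / 2 < α) {s : ℕ} (γ : Fin s → ℝ) (hγ : ∀ j, 0 < γ j) :
    RKernel (Fin s → Set.Icc (0 : ℝ) 1) :=
  RKernel.pi fun j => kor α hα (γ j) (hγ j)

/-- The kernel `K^{cos}_{α,γ,s}`. -/
def cosineS (α : ℝ) (hα : 1 / 2 < α) {s : ℕ} (γ : Fin s → ℝ) (hγ : ∀ j, 0 < γ j) :
    RKernel (Fin s → Set.Icc (0 : ℝ) 1) :=
  RKernel.pi fun j => cosine α hα (γ j) (hγ j)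

/-- The kernel `K^{kor+cos}_{α,γ,s}`. -/
def korCosS (α : ℝ) (hα : 1 / 2 < α) {s : ℕ} (γ : Fin s → ℝ) (hγ : ∀ j, 0 < γ j) :
    RKernel (Fin s → Set.Icc (0 : ℝ) 1) :=
  RKernel.pi fun j => korCos α hα (γ j) (hγ j)

/-- The kernel `K^{sob}_{α,γ,s}`. -/
def sobS (α : ℕ) (hα : 1 ≤ α) {s : ℕ} (γ : Fin s → ℝ) (hγ : ∀ j, 0 < γ j) :
    RKernel (Fin s → Set.Icc (0 : ℝ) 1) :=
  RKernel.pi fun j => sob α hα (γ j) (hγ j)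

theorem half_lt_one : (1 / 2 : ℝ) < 1 := by norm_num

theorem half_lt_natCast {α : ℕ} (hα : 1 < α) : (1 / 2 : ℝ) < α := by
  have : (1 : ℝ) < α := by exact_mod_cast hα
  linarith

end RKSpaces

end

noncomputable section

namespace RKSpaces

open Real

/-! An embedding `H(K₁) ↪ H(K₂)` follows from domination of kernels: it is enough that `c K₂ - K₁`
is positive semidefinite for some `c ≥ 0`. Domination passes to product kernels by Schur's product
theorem, so every embedding reduces to one variable and integer `α`.

In one variable write `C_β`, `S_β` for the series `∑ k^{-2α} cos(βkx) cos(βky)` and `∑ k^{-2α}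
sin(βkx) sin(βky)`. The Korobov kernel is `1 + 2γ (C_{2π} + S_{2π})`, the cosine kernel is `1 + 2γ
C_π`, and the Sobolev kernel is `1 + γ M_α`, where `M_α` is a sum of Bernoulli rank one kernels plus
a positive multiple of `C_{2π} + S_{2π}`. Korobov is therefore dominated by Sobolev at once. For `α
= 1` closed forms give `M_1 = (2/π²) C_π`, so Sobolev and cosine kernels dominate each other
(`sobMeanZero_one`).

That Sobolev dominates cosine for all integers `α ≥ 1` is proved by induction
(`dominated_halfPeriod_series`). Taking the mean-zero antiderivative in both variables preserves
positive semidefiniteness (`posSemidef_antideriv₂`) and sends `1 + M_α` to `M_{α+1}`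
(`antideriv₂_sob`). It turns `S_π` into a multiple of the next `C_π`, and `C_π` into a multiple of
the next `S_π` up to mean-value corrections that a constant kernel absorbs
(`Dominated.sinSeries_succ`). The induction must thus carry both series.

The noninclusions use two invariants. Korobov functions agree at `0` and `1` in each coordinate,
while a section of the cosine kernel does not. For `α ≥ 3/2`, functions of the cosine space have
one-sided derivative `0` at `0` along the sequence `1/n` in each coordinate: the difference
quotients are uniformly bounded functionals that vanish in the limit on kernel sections. The Korobov
function `∏ sin(2πx_j)` violates this. -/

theorem gram_posSemidef {X H : Type*} [NormedAddCommGroup H] [InnerProductSpace ℝ H] (v : X → H) :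
    (Matrix.of fun x y => inner ℝ (v x) (v y)).PosSemidef := by
  rw [posSemidef_iff_sum]
  refine ⟨fun x y => real_inner_comm _ _, fun t c => ?_⟩
  have : ∑ x ∈ t, ∑ y ∈ t, c x * inner ℝ (v x) (v y) * c y =
      inner ℝ (∑ x ∈ t, c x • v x) (∑ x ∈ t, c x • v x) := by
    simp only [sum_inner, inner_sum, inner_smul_left, inner_smul_right]
    simp only [conj_trivial]
    rw [Finset.sum_comm]
    exact Finset.sum_congr rfl fun x _ => by
      rw [Finset.mul_sum]; exact Finset.sum_congr rfl fun y _ => by ring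
  simp only [Matrix.of_apply, this]
  exact real_inner_self_nonneg

/-! ### Kernel sections, and embeddings from kernel inequalities -/

namespace RKernel

variable {X : Type*}

/-- The kernel section `K(·, x)` as an element of `H(K)`. -/
def ker (K : RKernel X) (x : X) : K.Space := RKHS.kerFun K.Space x 1

theorem inner_ker (K : RKernel X) (f : K.Space) (x : X) :
    inner ℝ f (K.ker x) = f x := by
  simp [ker]

theorem ker_apply (K : RKernel X) (x y : X) : K.ker x y = K y x := by
  rw [ker, RKHS.kerFun_apply, RKHS.OfKernel.kernel_ofKernel]
  simp [op]

theorem inner_ker_ker (K : RKernel X) (x y : X) :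
    inner ℝ (K.ker x) (K.ker y) = K x y := by
  rw [inner_ker, ker_apply]
  exact ((posSemidef_iff_sum _).1 K.posSemidef).1 y x

theorem ker_mem_functions (K : RKernel X) (x : X) : (fun y => K y x) ∈ K.functions :=
  ⟨K.ker x, funext fun y => K.ker_apply x y⟩

/-- Finite combinations of kernel sections. -/
def comb (K : RKernel X) : (X →₀ ℝ) →ₗ[ℝ] K.Space := Finsupp.linearCombination ℝ K.ker

theorem comb_single (K : RKernel X) (x : X) (a : ℝ) :
    K.comb (Finsupp.single x a) = a • K.ker x :=
  Finsupp.linearCombination_single ℝ a x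

theorem denseRange_comb (K : RKernel X) : DenseRange K.comb := by
  have h := RKHS.kerFun_dense K.Space
  have h2 : (LinearMap.range K.comb).topologicalClosure = ⊤ := by
    rw [eq_top_iff, ← h]
    refine Submodule.topologicalClosure_mono (Submodule.span_le.2 ?_)
    rintro _ ⟨x, v, rfl⟩
    refine ⟨Finsupp.single x v, ?_⟩
    rw [comb_single, ker, ← map_smul, smul_eq_mul, mul_one]
  have h3 := (Submodule.dense_iff_topologicalClosure_eq_top).2 h2
  exact h3

theorem norm_comb_sq (K : RKernel X) (c : X →₀ ℝ) :
    ‖K.comb c‖ ^ 2 = ∑ x ∈ c.support, ∑ y ∈ c.support, c x * K x y * c y := by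
  rw [← real_inner_self_eq_norm_sq, comb, Finsupp.linearCombination_apply, Finsupp.sum]
  simp only [sum_inner, inner_sum, inner_smul_left, inner_smul_right, inner_ker_ker]
  simp only [conj_trivial]
  rw [Finset.sum_comm]
  exact Finset.sum_congr rfl fun x _ => by
    rw [Finset.mul_sum]; exact Finset.sum_congr rfl fun y _ => by ring

/-- The hypothesis says that sending each section of `K₂` to the section of `K₁` at the same point
is bounded by `√c` on finite combinations, so it extends to all of `H(K₂)`. By the reproducing
property the adjoint of the extension leaves every function unchanged: it is the inclusion map. -/
theorem ContEmbedded.of_posSemidef {K₁ K₂ : RKernel X} {c : ℝ} (hc : 0 ≤ c)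
    (h : (c • K₂.toMatrix - K₁.toMatrix).PosSemidef) : K₁.ContEmbedded K₂ := by
  have hnorm : ∀ v, ‖K₁.comb v‖ ≤ √c * ‖K₂.comb v‖ := fun v => by
    refine le_of_sq_le_sq ?_ (by positivity)
    rw [mul_pow, sq_sqrt hc, norm_comb_sq, norm_comb_sq, ← sub_nonneg]
    refine (((posSemidef_iff_sum _).1 h).2 v.support v).trans_eq ?_
    simp only [Finset.mul_sum, ← Finset.sum_sub_distrib, Matrix.sub_apply, Matrix.smul_apply,
      smul_eq_mul]
    exact Finset.sum_congr rfl fun x _ => Finset.sum_congr rfl fun y _ => by ring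
  have hd := K₂.denseRange_comb
  set U : K₂.Space →L[ℝ] K₁.Space := K₁.comb.extendOfNorm K₂.comb
  have hU : ∀ x, U (K₂.ker x) = K₁.ker x := fun x => by
    have := LinearMap.extendOfNorm_eq hd ⟨_, hnorm⟩ (Finsupp.single x 1)
    rwa [comb_single, comb_single, one_smul, one_smul] at this
  have hUn : ‖U‖ ≤ √c := LinearMap.opNorm_extendOfNorm_le hd (sqrt_nonneg c) hnorm
  have key : ∀ f : K₁.Space, (U.adjoint f : X → ℝ) = f := fun f => by
    ext x
    rw [← inner_ker, ContinuousLinearMap.adjoint_inner_left, hU, inner_ker]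
  -- The summand `1` only makes the constant positive when `c = 0`.
  refine ⟨?_, √c + 1, by positivity, fun f₁ f₂ hf => ?_⟩
  · rintro _ ⟨f, rfl⟩
    exact ⟨U.adjoint f, key f⟩
  · have : f₂ = U.adjoint f₁ := DFunLike.coe_injective (hf.symm.trans (key f₁).symm)
    rw [this]
    refine (U.adjoint.le_opNorm f₁).trans ?_
    rw [LinearIsometryEquiv.norm_map]
    gcongr
    linarith

end RKernel

/-! ### The domination preorder on kernels -/

/-- `A ≼ B`: a nonnegative multiple of `B` exceeds `A` by a positive semidefinite matrix. -/
def Dominated {X : Type*} (A B : Matrix X X ℝ) : Prop := ∃ c : ℝ, 0 ≤ c ∧ (c • B - A).PosSemidef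

namespace Dominated

variable {X : Type*} {A B C D : Matrix X X ℝ}

theorem of_posSemidef_sub (h : (B - A).PosSemidef) : Dominated A B := ⟨1, one_pos.le, by simpa⟩

theorem trans (h₁ : Dominated A B) (h₂ : Dominated B C) : Dominated A C := by
  obtain ⟨c, hc, h₁⟩ := h₁
  obtain ⟨d, hd, h₂⟩ := h₂
  refine ⟨c * d, mul_nonneg hc hd, ?_⟩
  convert (h₂.smul hc).add h₁ using 1
  rw [smul_sub, smul_smul]; abel

theorem add (h₁ : Dominated A C) (h₂ : Dominated B C) : Dominated (A + B) C := by
  obtain ⟨c, hc, h₁⟩ := h₁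
  obtain ⟨d, hd, h₂⟩ := h₂
  refine ⟨c + d, add_nonneg hc hd, ?_⟩
  convert h₁.add h₂ using 1
  rw [add_smul]; abel

theorem smul {a : ℝ} (ha : 0 ≤ a) (h : Dominated A B) : Dominated (a • A) B := by
  obtain ⟨c, hc, h⟩ := h
  refine ⟨a * c, mul_nonneg ha hc, ?_⟩
  convert h.smul ha using 1
  rw [smul_sub, smul_smul]

theorem smul_right {a : ℝ} (ha : 0 < a) (A : Matrix X X ℝ) : Dominated A (a • A) :=
  ⟨a⁻¹, by positivity, by
    rw [smul_smul, inv_mul_cancel₀ ha.ne', one_smul, sub_self]; exact Matrix.PosSemidef.zero⟩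

theorem add_right (hB : B.PosSemidef) (A : Matrix X X ℝ) : Dominated A (A + B) :=
  of_posSemidef_sub (by simpa)

theorem add_left (hB : B.PosSemidef) (A : Matrix X X ℝ) : Dominated A (B + A) :=
  of_posSemidef_sub (by simpa)

end Dominated

theorem Dominated.contEmbedded {X : Type*} {K₁ K₂ : RKernel X}
    (h : Dominated K₁.toMatrix K₂.toMatrix) : K₁.ContEmbedded K₂ :=
  let ⟨_, hc, h⟩ := h
  .of_posSemidef hc h

/-- Factors are exchanged one at a time, each exchange being a Schur product of positive
semidefinite kernels. The induction also carries positivity of the partial products of `c j * L j`.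
-/
theorem RKernel.pi_dominated {X : Type*} {s : ℕ} {K L : Fin s → RKernel X}
    (h : ∀ j, Dominated (K j).toMatrix (L j).toMatrix) :
    Dominated (RKernel.pi K).toMatrix (RKernel.pi L).toMatrix := by
  classical
  choose c hc h using h
  refine ⟨∏ j, c j, Finset.prod_nonneg fun j _ => hc j, ?_⟩
  have key : ∀ t : Finset (Fin s), (Matrix.of fun x y : Fin s → X =>
      (∏ j ∈ t, c j * L j (x j) (y j)) - ∏ j ∈ t, K j (x j) (y j)).PosSemidef ∧
      (Matrix.of fun x y : Fin s → X => ∏ j ∈ t, c j * L j (x j) (y j)).PosSemidef := by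
    intro t
    induction t using Finset.induction_on with
    | empty => simpa using ⟨Matrix.PosSemidef.zero, posSemidef_const_one⟩
    | insert j t hj ih =>
      simp only [Finset.prod_insert hj]
      have hL : (Matrix.of fun x y : Fin s → X => c j * L j (x j) (y j)).PosSemidef :=
        ((L j).posSemidef.smul (hc j)).submatrix fun x : Fin s → X => x j
      refine ⟨?_, posSemidef_mul hL ih.2⟩
      -- With `P`, `Q` the remaining products, `cL·P - K·Q = (cL - K)·P + K·(P - Q)`.
      convert (posSemidef_mul ((h j).submatrix fun x : Fin s → X => x j) ih.2).add
        (posSemidef_mul ((K j).posSemidef.submatrix fun x : Fin s → X => x j) ih.1) using 1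
      ext x y
      simp only [Matrix.of_apply, Matrix.add_apply, Matrix.submatrix_apply, Matrix.sub_apply,
        Matrix.smul_apply, smul_eq_mul]
      ring
  convert (key Finset.univ).1 using 1
  ext x y
  simp [RKernel.pi, Finset.prod_mul_distrib]

/-! ### Functionals that detect noninclusion -/

open Filter Topology

namespace RKernel

variable {X : Type*}

theorem eq_of_forall_kernel_eq {K : RKernel X} {p q : X} (h : ∀ y, K p y = K q y)
    {f : X → ℝ} (hf : f ∈ K.functions) : f p = f q := by
  obtain ⟨f, rfl⟩ := hf
  have : K.ker p = K.ker q := by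
    ext y
    have hs := ((posSemidef_iff_sum _).1 K.posSemidef).1
    rw [ker_apply, ker_apply, hs, h, hs]
  change f p = f q
  rw [← inner_ker, this, inner_ker]

/-- Uniformly bounded functionals that converge to zero on all kernel sections converge to zero on
all of `H(K)`; here the functionals are multiples of differences of point evaluations. -/
theorem tendsto_difference {K : RKernel X} {c : ℕ → ℝ} {p q : ℕ → X} {M : ℝ}
    (hM : ∀ n, c n ^ 2 * (K (p n) (p n) - 2 * K (p n) (q n) + K (q n) (q n)) ≤ M)
    (h0 : ∀ y, Tendsto (fun n => c n * (K (p n) y - K (q n) y)) atTop (𝓝 0))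
    {f : X → ℝ} (hf : f ∈ K.functions) :
    Tendsto (fun n => c n * (f (p n) - f (q n))) atTop (𝓝 0) := by
  obtain ⟨f, rfl⟩ := hf
  set v : ℕ → K.Space := fun n => c n • (K.ker (p n) - K.ker (q n)) with hv
  have hvf : ∀ g : K.Space, ∀ n, inner ℝ g (v n) = c n * (g (p n) - g (q n)) := fun g n => by
    rw [hv, inner_smul_right, inner_sub_right, inner_ker, inner_ker]
  have hvn : ∀ n, ‖v n‖ ≤ √M := fun n => by
    refine le_sqrt_of_sq_le ?_
    refine (le_of_eq ?_).trans (hM n)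
    rw [hv, norm_smul, mul_pow, norm_sub_sq_real, inner_ker_ker, Real.norm_eq_abs, sq_abs,
      ← real_inner_self_eq_norm_sq (K.ker (p n)), ← real_inner_self_eq_norm_sq (K.ker (q n)),
      inner_ker_ker, inner_ker_ker]
  have hcomb : ∀ w, Tendsto (fun n => inner ℝ (K.comb w) (v n)) atTop (𝓝 0) := fun w => by
    have e : ∀ n, inner ℝ (K.comb w) (v n) =
        ∑ y ∈ w.support, w y * (c n * (K (p n) y - K (q n) y)) := fun n => by
      rw [comb, Finsupp.linearCombination_apply, Finsupp.sum, sum_inner]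
      refine Finset.sum_congr rfl fun y _ => ?_
      rw [inner_smul_left, hvf, ker_apply, ker_apply]
      simp
    simp only [e]
    simpa using tendsto_finsetSum w.support fun y _ => (h0 y).const_mul (w y)
  suffices Tendsto (fun n => inner ℝ f (v n)) atTop (𝓝 0) by simpa only [hvf] using this
  rw [Metric.tendsto_atTop]
  intro ε hε
  -- Adding `1` to `√M` avoids division by zero when `M = 0`.
  obtain ⟨w, hw⟩ := K.denseRange_comb.exists_dist_lt f (ε := ε / 2 / (√M + 1)) (by positivity)
  obtain ⟨N, hN⟩ := Metric.tendsto_atTop.1 (hcomb w) (ε / 2) (by positivity)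
  refine ⟨N, fun n hn => ?_⟩
  have h1 := hN n hn
  rw [dist_zero_right, Real.norm_eq_abs] at h1 ⊢
  have h2 : inner ℝ f (v n) = inner ℝ (f - K.comb w) (v n) + inner ℝ (K.comb w) (v n) := by
    rw [inner_sub_left]; ring
  have h3 : |inner ℝ (f - K.comb w) (v n)| ≤ ε / 2 := by
    refine (abs_real_inner_le_norm _ _).trans ?_
    rw [dist_eq_norm] at hw
    calc ‖f - K.comb w‖ * ‖v n‖ ≤ ε / 2 / (√M + 1) * (√M + 1) := by
          gcongr
          exact (hvn n).trans (by linarith)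
      _ = ε / 2 := by field_simp
  rw [h2]
  exact (abs_add_le _ _).trans_lt (by linarith)

theorem pi_update_apply {s : ℕ} (K : Fin s → RKernel X) (z : Fin s → X) (j : Fin s) (x : X)
    (y : Fin s → X) : RKernel.pi K (Function.update z j x) y =
      K j x (y j) * ∏ i ∈ Finset.univ.erase j, K i (z i) (y i) := by
  change ∏ i, K i (Function.update z j x i) (y i) = _
  rw [← Finset.mul_prod_erase _ _ (Finset.mem_univ j), Function.update_self]
  congr 1
  refine Finset.prod_congr rfl fun i hi => ?_
  rw [Function.update_of_ne (Finset.ne_of_mem_erase hi)]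

theorem apply_self_nonneg (K : RKernel X) (x : X) : 0 ≤ K x x := by
  simpa using ((posSemidef_iff_sum _).1 K.posSemidef).2 {x} 1

/-- Only coordinate `j` moves, so the other factors contribute constants: `∏ K i (z i) (z i)` in the
norm bound and `∏ K i (z i) (y i)` on a section. -/
theorem tendsto_difference_pi {s : ℕ} {K : Fin s → RKernel X} (z : Fin s → X) (j : Fin s)
    {c : ℕ → ℝ} {p q : ℕ → X} {M : ℝ}
    (hM : ∀ n, c n ^ 2 * (K j (p n) (p n) - 2 * K j (p n) (q n) + K j (q n) (q n)) ≤ M)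
    (h0 : ∀ y, Tendsto (fun n => c n * (K j (p n) y - K j (q n) y)) atTop (𝓝 0))
    {f : (Fin s → X) → ℝ} (hf : f ∈ (RKernel.pi K).functions) :
    Tendsto (fun n => c n * (f (Function.update z j (p n)) - f (Function.update z j (q n))))
      atTop (𝓝 0) := by
  have hP : ∀ x, ∏ i ∈ Finset.univ.erase j, K i (z i) (Function.update z j x i) =
      ∏ i ∈ Finset.univ.erase j, K i (z i) (z i) := fun x =>
    Finset.prod_congr rfl fun i hi => by
      rw [Function.update_of_ne (Finset.ne_of_mem_erase hi)]
  refine tendsto_difference (M := M * ∏ i ∈ Finset.univ.erase j, K i (z i) (z i))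
    (fun n => ?_) (fun y => ?_) hf
  · simp only [pi_update_apply, hP, Function.update_self]
    refine (le_of_eq ?_).trans (mul_le_mul_of_nonneg_right (hM n)
      (Finset.prod_nonneg fun i _ => (K i).apply_self_nonneg (z i)))
    ring
  · simp only [pi_update_apply]
    have := (h0 (y j)).mul_const (∏ i ∈ Finset.univ.erase j, K i (z i) (y i))
    rw [zero_mul] at this
    exact this.congr fun n => by ring

/-- The kernel `u(x) u(y)`. -/
def rankOne (u : X → ℝ) : RKernel X where
  toMatrix := Matrix.of fun x y => u x * u y
  posSemidef := by simpa using posSemidef_rankOne 1 one_pos.le u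

/-- The product of the rank one kernels has the function `∏ u (x j)` as its section at `(a, …, a)`,
because `u a = 1`; domination carries it into the larger space. -/
theorem mem_functions_pi_of_rankOne {s : ℕ} {K : Fin s → RKernel X} {u : X → ℝ} {a : X}
    (ha : u a = 1) (h : ∀ j, Dominated (rankOne u).toMatrix (K j).toMatrix) :
    (fun x => ∏ j, u (x j)) ∈ (RKernel.pi K).functions := by
  refine (pi_dominated h).contEmbedded.1 ?_
  convert ker_mem_functions (RKernel.pi fun _ : Fin s => rankOne u) (fun _ => a) using 1
  ext x
  simp [RKernel.pi, rankOne, ha]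

end RKernel

/-! ### Estimates for the cosine kernel near zero -/

/-- Combines the quadratic bound for small `v` with the bound `2` for large `v`; the constant is
`16/2 + 2`, from `π² ≤ 16`. -/
theorem one_sub_cos_mul_le (v : ℝ) : (1 - cos (π * v)) * (1 + v ^ 2) ≤ 10 * v ^ 2 := by
  have h1 : 1 - cos (π * v) ≤ (π * v) ^ 2 / 2 := by
    linarith [one_sub_sq_div_two_le_cos (x := π * v)]
  have h2 : 1 - cos (π * v) ≤ 2 := by linarith [neg_one_le_cos (π * v)]
  have h3 : π ^ 2 ≤ 16 := by nlinarith [pi_pos, pi_le_four]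
  nlinarith [mul_le_mul_of_nonneg_right h2 (sq_nonneg v),
    mul_le_mul_of_nonneg_right h3 (sq_nonneg v)]

theorem one_sub_cos_le_self {u : ℝ} (hu : 0 ≤ u) : 1 - cos u ≤ u := by
  rcases le_total u 2 with h | h
  · nlinarith [one_sub_sq_div_two_le_cos (x := u)]
  · linarith [neg_one_le_cos u]

theorem weight_natCast_succ (α γ : ℝ) (k : ℕ) :
    weight α γ ((k : ℤ) + 1) = γ * ((k : ℝ) + 1) ^ (-2 * α) := by
  have h : ((k : ℤ) + 1) ≠ 0 := by omega
  have : |((k : ℝ) + 1)| = (k : ℝ) + 1 := abs_of_pos (by positivity)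
  simp [weight, h, this]

theorem weight_le_of_three_halves_le {α γ : ℝ} (hα : 3 / 2 ≤ α) (hγ : 0 < γ) (k : ℕ) :
    weight α γ ((k : ℤ) + 1) ≤ γ / ((k : ℝ) + 1) ^ 3 := by
  rw [weight_natCast_succ, div_eq_mul_inv]
  refine mul_le_mul_of_nonneg_left ?_ hγ.le
  rw [← rpow_natCast, ← rpow_neg (by positivity)]
  exact rpow_le_rpow_of_exponent_le (by linarith [k.cast_nonneg (α := ℝ)])
    (by push_cast; linarith)

theorem summable_cosFun {α : ℝ} (hα : 1 / 2 < α) {γ : ℝ} (hγ : 0 < γ) (x y : ℝ) :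
    Summable fun k : ℕ => weight α γ ((k : ℤ) + 1) * (√2 * cos (π * ((k : ℝ) + 1) * x)) *
      (√2 * cos (π * ((k : ℝ) + 1) * y)) := by
  have hw : Summable fun k : ℕ => weight α γ ((k : ℤ) + 1) * 2 :=
    ((summable_weight hα γ).comp_injective
      (i := fun k : ℕ => (k : ℤ) + 1) fun a b h => by simpa using h).mul_right 2
  refine Summable.of_norm_bounded hw fun k => ?_
  have h2 : √2 * √2 = 2 := mul_self_sqrt (by norm_num)
  have hw0 := weight_nonneg α hγ ((k : ℤ) + 1)
  have e : weight α γ ((k : ℤ) + 1) * (√2 * cos (π * ((k : ℝ) + 1) * x)) *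
      (√2 * cos (π * ((k : ℝ) + 1) * y)) = weight α γ ((k : ℤ) + 1) * 2 *
      (cos (π * ((k : ℝ) + 1) * x) * cos (π * ((k : ℝ) + 1) * y)) := by
    linear_combination (weight α γ ((k : ℤ) + 1) * cos (π * ((k : ℝ) + 1) * x) *
      cos (π * ((k : ℝ) + 1) * y)) * h2
  rw [e, norm_mul, Real.norm_of_nonneg (by positivity)]
  refine mul_le_of_le_one_right (by positivity) ?_
  rw [norm_mul]
  exact mul_le_one₀ (abs_cos_le_one _) (norm_nonneg _) (abs_cos_le_one _)

theorem hasSum_cosFun_sub {α : ℝ} (hα : 1 / 2 < α) {γ : ℝ} (hγ : 0 < γ) (x y z : ℝ) :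
    HasSum (fun k : ℕ => 2 * weight α γ ((k : ℤ) + 1) *
      (cos (π * ((k : ℝ) + 1) * x) - cos (π * ((k : ℝ) + 1) * y)) * cos (π * ((k : ℝ) + 1) * z))
      (cosFun α γ x z - cosFun α γ y z) := by
  have h := (summable_cosFun hα hγ x z).hasSum.sub (summable_cosFun hα hγ y z).hasSum
  have e : cosFun α γ x z - cosFun α γ y z = _ := add_sub_add_left_eq_sub _ _ _
  rw [e]
  refine h.congr_fun fun k => ?_
  have h2 : √2 * √2 = 2 := mul_self_sqrt (by norm_num)
  linear_combination (-weight α γ ((k : ℤ) + 1) *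
    (cos (π * ((k : ℝ) + 1) * x) - cos (π * ((k : ℝ) + 1) * y)) *
    cos (π * ((k : ℝ) + 1) * z)) * h2

theorem cosFun_comm (α γ x y : ℝ) : cosFun α γ x y = cosFun α γ y x := by
  simp only [cosFun]
  congr 1
  exact tsum_congr fun k => by ring

theorem cosFun_zero_one_lt {α : ℝ} (hα : 1 / 2 < α) {γ : ℝ} (hγ : 0 < γ) :
    cosFun α γ 1 0 < cosFun α γ 0 0 := by
  rw [← sub_pos]
  have h := hasSum_cosFun_sub hα hγ 0 1 0
  rw [← h.tsum_eq]
  refine h.summable.tsum_pos (fun k => ?_) 0 ?_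
  · have := weight_nonneg α hγ ((k : ℤ) + 1)
    simp only [mul_zero, cos_zero, mul_one]
    exact mul_nonneg (by positivity) (by linarith [cos_le_one (π * ((k : ℝ) + 1))])
  · rw [weight_natCast_succ]
    simp
    linarith

theorem one_le_cosFun_zero_zero (α : ℝ) {γ : ℝ} (hγ : 0 < γ) : 1 ≤ cosFun α γ 0 0 := by
  have : 0 ≤ ∑' k : ℕ, weight α γ ((k : ℤ) + 1) * (√2 * cos (π * ((k : ℝ) + 1) * 0)) *
      (√2 * cos (π * ((k : ℝ) + 1) * 0)) := tsum_nonneg fun k => by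
    have := weight_nonneg α hγ ((k : ℤ) + 1)
    simp only [mul_zero, cos_zero, mul_one]
    positivity
  simp only [cosFun]
  linarith

/-- This bounds the squared norm of the functional `N (f(1/N) - f(0))` uniformly in `N`. The squared
norm is `2N² ∑ weight(m) (1 - cos(πm/N))²`, and the cubic weight decay at `α = 3/2` is just enough:
the terms grow like `m` up to `m ≈ N` and decay like `m⁻³` beyond. -/
theorem cosFun_second_difference_le {α : ℝ} (hα : 3 / 2 ≤ α) {γ : ℝ} (hγ : 0 < γ) (n : ℕ) :
    ((n : ℝ) + 1) ^ 2 * (cosFun α γ (1 / (n + 1)) (1 / (n + 1)) - 2 * cosFun α γ (1 / (n + 1)) 0 +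
      cosFun α γ 0 0) ≤ 100 * γ := by
  have hα' : 1 / 2 < α := by linarith
  set N : ℝ := (n : ℝ) + 1 with hN
  have hN0 : 0 < N := by positivity
  have h := ((hasSum_cosFun_sub hα' hγ (1 / N) 0 (1 / N)).sub
    (hasSum_cosFun_sub hα' hγ (1 / N) 0 0)).mul_left (N ^ 2)
  rw [cosFun_comm α γ 0 (1 / N)] at h
  have e : N ^ 2 * (cosFun α γ (1 / N) (1 / N) - cosFun α γ (1 / N) 0 -
      (cosFun α γ (1 / N) 0 - cosFun α γ 0 0)) = N ^ 2 * (cosFun α γ (1 / N) (1 / N) -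
      2 * cosFun α γ (1 / N) 0 + cosFun α γ 0 0) := by ring
  rw [e] at h
  -- With `m = k + 1`, the difference `G k - G (k + 1)` equals `2m / ((N² + m²)² - m²)`. It
  -- majorises the term `2m / (N² + m²)²`, so the sum telescopes to at most `N² G 0 = 1`.
  set G : ℕ → ℝ := fun k => 1 / (N ^ 2 + (k + 1) * k) with hG
  have hG0 : ∀ k, 0 ≤ G k := fun k => by positivity
  have key : ∀ k : ℕ, N ^ 2 * (2 * weight α γ ((k : ℤ) + 1) *
      (cos (π * ((k : ℝ) + 1) * (1 / N)) - cos (π * ((k : ℝ) + 1) * 0)) *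
        cos (π * ((k : ℝ) + 1) * (1 / N)) - 2 * weight α γ ((k : ℤ) + 1) *
      (cos (π * ((k : ℝ) + 1) * (1 / N)) - cos (π * ((k : ℝ) + 1) * 0)) *
        cos (π * ((k : ℝ) + 1) * 0)) ≤ 100 * γ * N ^ 2 * (G k - G (k + 1)) := fun k => by
    set m : ℝ := (k : ℝ) + 1 with hm
    have hm0 : 0 < m := by positivity
    have hc := one_sub_cos_mul_le (m / N)
    have hc0 : 0 ≤ 1 - cos (π * (m / N)) := by linarith [cos_le_one (π * (m / N))]
    have hc1 : 1 - cos (π * (m / N)) ≤ 10 * m ^ 2 / (N ^ 2 + m ^ 2) := by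
      rw [le_div_iff₀ (by positivity)]
      have := mul_le_mul_of_nonneg_right hc (sq_nonneg N)
      calc _ = (1 - cos (π * (m / N))) * (1 + (m / N) ^ 2) * N ^ 2 := by field_simp
        _ ≤ _ := this
        _ = _ := by field_simp
    have hw := weight_le_of_three_halves_le hα hγ k
    have hw0 := weight_nonneg α hγ ((k : ℤ) + 1)
    have hGk : 2 * m / (N ^ 2 + m ^ 2) ^ 2 ≤ G k - G (k + 1) := by
      have hk : (k : ℝ) = m - 1 := by rw [hm]; ring
      have hk0 : (0 : ℝ) ≤ m - 1 := hk ▸ k.cast_nonneg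
      have e1 : G k - G (k + 1) = 2 * m / ((N ^ 2 + m ^ 2) ^ 2 - m ^ 2) := by
        simp only [hG]
        push_cast
        rw [hk]
        have a1 : N ^ 2 + (m - 1 + 1) * (m - 1) ≠ 0 := by nlinarith [mul_nonneg hm0.le hk0]
        have a2 : N ^ 2 + (m - 1 + 1 + 1) * (m - 1 + 1) ≠ 0 := by positivity
        have a3 : (N ^ 2 + m ^ 2) ^ 2 - m ^ 2 =
          (N ^ 2 + (m - 1 + 1) * (m - 1)) * (N ^ 2 + (m - 1 + 1 + 1) * (m - 1 + 1)) := by ring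
        rw [a3]
        field_simp
        ring
      rw [e1]
      refine div_le_div_of_nonneg_left (by positivity) ?_ (by nlinarith)
      have : (N ^ 2 + m ^ 2) ^ 2 - m ^ 2 = N ^ 2 * (N ^ 2 + 2 * m ^ 2) + m ^ 2 * (m ^ 2 - 1) := by
        ring
      rw [this]
      have : 0 ≤ m ^ 2 - 1 := by nlinarith
      positivity
    have e0 : π * m * (1 / N) = π * (m / N) := by ring
    rw [e0, mul_zero, cos_zero]
    set d := 1 - cos (π * (m / N)) with hd
    calc _ = N ^ 2 * (2 * weight α γ ((k : ℤ) + 1) * d ^ 2) := by rw [hd]; ring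
      _ ≤ N ^ 2 * (2 * (γ / m ^ 3) * (10 * m ^ 2 / (N ^ 2 + m ^ 2)) ^ 2) := by gcongr
      _ = 100 * γ * N ^ 2 * (2 * m / (N ^ 2 + m ^ 2) ^ 2) := by field_simp; ring
      _ ≤ _ := by gcongr
  refine le_of_tendsto' h.tendsto_sum_nat fun T => ?_
  refine (Finset.sum_le_sum fun k _ => key k).trans ?_
  rw [← Finset.mul_sum, Finset.sum_range_sub']
  have : N ^ 2 * G 0 = 1 := by simp [hG]; field_simp
  have h2 : 0 ≤ N ^ 2 * G T := mul_nonneg (by positivity) (hG0 T)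
  nlinarith

/-- Each cosine has zero derivative at `0`. Dominated convergence allows the termwise limit, since
`1 - cos u ≤ u` and the cubic decay of the weights bound the terms by `2γπ/m²` independently of `n`.
-/
theorem tendsto_cosFun_difference {α : ℝ} (hα : 3 / 2 ≤ α) {γ : ℝ} (hγ : 0 < γ) (y : ℝ) :
    Tendsto (fun n : ℕ => ((n : ℝ) + 1) * (cosFun α γ (1 / (n + 1)) y - cosFun α γ 0 y))
      atTop (𝓝 0) := by
  have hα' : 1 / 2 < α := by linarith
  have h := fun n : ℕ => (hasSum_cosFun_sub hα' hγ (1 / ((n : ℝ) + 1)) 0 y).mul_left ((n : ℝ) + 1)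
  simp only [← fun n => (h n).tsum_eq]
  have hb : Summable fun k : ℕ => 2 * γ * π * (1 / ((k : ℝ) + 1) ^ 2) := by
    refine Summable.mul_left _ ?_
    have := (summable_nat_add_iff 1).2 (Real.summable_one_div_nat_pow.2 one_lt_two)
    simpa using this
  suffices h' : Tendsto _ _ (𝓝 (∑' _ : ℕ, (0 : ℝ))) by rwa [tsum_zero] at h'
  refine tendsto_tsum_of_dominated_convergence hb (fun k => ?_) (.of_forall fun n k => ?_)
  · set m : ℝ := (k : ℝ) + 1
    have h1 : Tendsto (fun n : ℕ => (π * m) ^ 2 * (1 / ((n : ℝ) + 1))) atTop (𝓝 0) := by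
      simpa using (tendsto_one_div_add_atTop_nhds_zero_nat (𝕜 := ℝ)).const_mul ((π * m) ^ 2)
    have h2 : Tendsto (fun n : ℕ => ((n : ℝ) + 1) * (cos (π * m * (1 / ((n : ℝ) + 1))) - 1))
        atTop (𝓝 0) := by
      refine squeeze_zero_norm (fun n => ?_) h1
      have hn : (0 : ℝ) < (n : ℝ) + 1 := by positivity
      rw [norm_mul, Real.norm_of_nonneg hn.le, Real.norm_eq_abs, abs_sub_comm,
        abs_of_nonneg (by linarith [cos_le_one (π * m * (1 / ((n : ℝ) + 1)))])]
      have := one_sub_sq_div_two_le_cos (x := π * m * (1 / ((n : ℝ) + 1)))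
      calc ((n : ℝ) + 1) * (1 - cos (π * m * (1 / ((n : ℝ) + 1)))) ≤
            ((n : ℝ) + 1) * (π * m * (1 / ((n : ℝ) + 1))) ^ 2 := by
            gcongr
            nlinarith [sq_nonneg (π * m * (1 / ((n : ℝ) + 1)))]
        _ = _ := by field_simp
    have h3 := h2.const_mul (2 * weight α γ ((k : ℤ) + 1) * cos (π * m * y))
    rw [mul_zero] at h3
    refine h3.congr fun n => ?_
    rw [mul_zero, cos_zero]
    ring
  · set m : ℝ := (k : ℝ) + 1
    set N : ℝ := (n : ℝ) + 1
    have hm0 : 0 < m := by positivity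
    have hN0 : 0 < N := by positivity
    have hw := weight_le_of_three_halves_le hα hγ k
    have hw0 := weight_nonneg α hγ ((k : ℤ) + 1)
    have hc := one_sub_cos_le_self (u := π * m * (1 / N)) (by positivity)
    have hc0 : 0 ≤ 1 - cos (π * m * (1 / N)) := by linarith [cos_le_one (π * m * (1 / N))]
    rw [mul_zero, cos_zero, norm_mul, norm_mul, norm_mul, Real.norm_of_nonneg hN0.le,
      Real.norm_of_nonneg (by positivity : 0 ≤ 2 * weight α γ ((k : ℤ) + 1)), Real.norm_eq_abs,
      Real.norm_eq_abs, abs_sub_comm, abs_of_nonneg hc0]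
    calc _ ≤ N * (2 * (γ / m ^ 3) * (π * m * (1 / N)) * 1) := by
          gcongr
          exact abs_cos_le_one _
      _ = _ := by field_simp

/-- The weight at `h = 1` is `γ`, so after scaling that term is `cos cos + sin sin`; removing the
sine part leaves the positive `cos cos`. -/
theorem dominated_rankOne_sin_kor {α : ℝ} (hα : 1 / 2 < α) {γ : ℝ} (hγ : 0 < γ) :
    Dominated (RKernel.rankOne fun x : Set.Icc (0 : ℝ) 1 => sin (2 * π * x)).toMatrix
      (kor α hα γ hγ).toMatrix := by
  refine ⟨γ⁻¹, by positivity, ?_⟩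
  refine posSemidef_of_hasSum (ι := ℤ) (A := fun h => Matrix.of fun x y : Set.Icc (0 : ℝ) 1 =>
    γ⁻¹ * (weight α γ h * cos (2 * π * h * ((x : ℝ) - y))) -
      if h = 1 then sin (2 * π * x) * sin (2 * π * y) else 0) (fun h => ?_) fun x y => ?_
  · by_cases h1 : h = 1
    · subst h1
      convert posSemidef_rankOne 1 one_pos.le fun x : Set.Icc (0 : ℝ) 1 => cos (2 * π * x) using 1
      ext x y
      simp [weight, mul_sub, cos_sub, hγ.ne']
    · simp only [h1, if_false, sub_zero, ← mul_assoc]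
      exact posSemidef_cos_sub (mul_nonneg (by positivity) (weight_nonneg α hγ h)) _ Subtype.val
  · exact ((hasSum_korFun hα hγ x y).mul_left γ⁻¹).sub (hasSum_ite_eq 1 _)

theorem korFun_one_left {α : ℝ} (hα : 1 / 2 < α) {γ : ℝ} (hγ : 0 < γ) (y : ℝ) :
    korFun α γ 1 y = korFun α γ 0 y := by
  refine (hasSum_korFun hα hγ 1 y).unique ((hasSum_korFun hα hγ 0 y).congr_fun fun h => ?_)
  have : 2 * π * h * (1 - y) = 2 * π * h * (0 - y) + h * (2 * π) := by ring
  rw [this, cos_add_int_mul_two_pi]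

/-! ### The noninclusions -/

section Noninclusion

variable {s : ℕ} (γ : Fin s → ℝ) (hγ : ∀ j, 0 < γ j)

theorem cosineS_not_subset_korS (hs : 1 ≤ s) {α : ℝ} (hα : 1 / 2 < α) :
    ¬ (cosineS α hα γ hγ).functions ⊆ (korS α hα γ hγ).functions := by
  intro hsub
  let j : Fin s := ⟨0, hs⟩
  let O : Set.Icc (0 : ℝ) 1 := ⟨0, by norm_num⟩
  let I : Set.Icc (0 : ℝ) 1 := ⟨1, by norm_num⟩
  let z : Fin s → Set.Icc (0 : ℝ) 1 := fun _ => O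
  have hf := hsub ((cosineS α hα γ hγ).ker_mem_functions z)
  have h := RKernel.eq_of_forall_kernel_eq (p := Function.update z j I)
    (q := Function.update z j O) (fun y => ?_) hf
  · simp only [cosineS, RKernel.pi_update_apply] at h
    refine absurd (mul_right_cancel₀ (Finset.prod_ne_zero_iff.2 fun i _ => ?_) h) ?_
    · exact (one_pos.trans_le (one_le_cosFun_zero_zero α (hγ i))).ne'
    · exact (cosFun_zero_one_lt hα (hγ j)).ne
  · simp only [korS, RKernel.pi_update_apply]
    congr 1
    exact korFun_one_left hα (hγ j) (y j)

theorem korS_not_subset_cosineS (hs : 1 ≤ s) {α : ℝ} (hα : 1 / 2 < α) (hα' : 3 / 2 ≤ α) :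
    ¬ (korS α hα γ hγ).functions ⊆ (cosineS α hα γ hγ).functions := by
  intro hsub
  let j : Fin s := ⟨0, hs⟩
  let a : Set.Icc (0 : ℝ) 1 := ⟨1 / 4, by norm_num⟩
  let O : Set.Icc (0 : ℝ) 1 := ⟨0, by norm_num⟩
  let p : ℕ → Set.Icc (0 : ℝ) 1 := fun n => ⟨1 / ((n : ℝ) + 1), by positivity, by
    rw [div_le_one (by positivity)]; linarith [n.cast_nonneg (α := ℝ)]⟩
  have ha : sin (2 * π * (a : ℝ)) = 1 := by
    have : 2 * π * (a : ℝ) = π / 2 := by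
      change 2 * π * (1 / 4) = _
      ring
    rw [this, sin_pi_div_two]
  have hf := hsub (RKernel.mem_functions_pi_of_rankOne (a := a) ha
    fun j => dominated_rankOne_sin_kor hα (hγ j))
  have h := RKernel.tendsto_difference_pi (fun _ => a) j (c := fun n => (n : ℝ) + 1) (p := p)
    (q := fun _ => O) (cosFun_second_difference_le hα' (hγ j))
    (fun y => tendsto_cosFun_difference hα' (hγ j) y) hf
  have hu : ∀ x : Set.Icc (0 : ℝ) 1, ∏ i, sin (2 * π * (Function.update (fun _ => a) j x i : ℝ)) =
      sin (2 * π * x) := fun x => by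
    rw [← Finset.mul_prod_erase _ _ (Finset.mem_univ j), Function.update_self,
      Finset.prod_eq_one, mul_one]
    intro i hi
    rw [Function.update_of_ne (Finset.ne_of_mem_erase hi), ha]
  simp only [hu] at h
  -- The quotients tend to `0`, yet Jordan's inequality `sin t ≥ 2t/π` at `t = 2π/(n+1)` keeps them
  -- at least `4`. Taking `n ≥ 3` ensures `t ≤ π/2`.
  refine absurd (ge_of_tendsto (b := 4) h ?_) (by norm_num)
  filter_upwards [eventually_ge_atTop 3] with n hn
  have hn' : (3 : ℝ) ≤ n := by exact_mod_cast hn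
  have hN : (0 : ℝ) < (n : ℝ) + 1 := by positivity
  have h1 := mul_le_sin (x := 2 * π * (1 / ((n : ℝ) + 1))) (by positivity) (by
    have : 1 / ((n : ℝ) + 1) ≤ 1 / 4 := one_div_le_one_div_of_le (by norm_num) (by linarith)
    nlinarith [pi_pos])
  have h2 : sin (2 * π * (O : ℝ)) = 0 := by simp [O]
  rw [h2, sub_zero]
  calc (4 : ℝ) = ((n : ℝ) + 1) * (2 / π * (2 * π * (1 / ((n : ℝ) + 1)))) := by field_simp; norm_num
    _ ≤ _ := by gcongr

end Noninclusion

/-! ### The mean-zero antiderivative -/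

open MeasureTheory

/-- The antiderivative of `g` with mean value zero. -/
def antideriv {E : Type*} [NormedAddCommGroup E] [NormedSpace ℝ E] (g : Set.Icc (0 : ℝ) 1 → E)
    (x : Set.Icc (0 : ℝ) 1) : E :=
  ∫ t : unitInterval, ((x : ℝ) • g (x * t) - (1 - (t : ℝ)) • g t)

theorem integrable_unitInterval {E : Type*} [NormedAddCommGroup E] {f : unitInterval → E}
    (hf : Continuous f) : Integrable f :=
  integrableOn_univ.1 (hf.continuousOn.integrableOn_compact isCompact_univ)

theorem integral_unitInterval (f : ℝ → ℝ) :
    ∫ t : unitInterval, f t = ∫ t in (0 : ℝ)..1, f t := by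
  rw [unitInterval.measurePreserving_coe.integral_comp unitInterval.measurableEmbedding_coe,
    intervalIntegral.integral_of_le zero_le_one, integral_Icc_eq_integral_Ioc]

section antideriv

variable {E : Type*} [NormedAddCommGroup E] [NormedSpace ℝ E]

@[fun_prop]
theorem continuous_antideriv_integrand {g : Set.Icc (0 : ℝ) 1 → E} (hg : Continuous g)
    (x : Set.Icc (0 : ℝ) 1) :
    Continuous fun t : unitInterval => (x : ℝ) • g (x * t) - (1 - (t : ℝ)) • g t := by
  fun_prop

/-- Integrating over a fixed interval, with the variable rescaled to `x t`, makes this a plain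
exchange of integral and inner product, valid for Hilbert space valued curves. -/
theorem inner_antideriv {H : Type*} [NormedAddCommGroup H] [InnerProductSpace ℝ H]
    [CompleteSpace H] {Φ : Set.Icc (0 : ℝ) 1 → H} (hΦ : Continuous Φ) (w : H)
    (x : Set.Icc (0 : ℝ) 1) :
    inner ℝ w (antideriv Φ x) = antideriv (fun t => inner ℝ w (Φ t)) x := by
  rw [antideriv, ← integral_inner (integrable_unitInterval (by fun_prop))]
  simp only [antideriv, inner_sub_right, inner_smul_right, smul_eq_mul]

theorem antideriv_add {g h : Set.Icc (0 : ℝ) 1 → E} (hg : Continuous g) (hh : Continuous h)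
    (x : Set.Icc (0 : ℝ) 1) :
    antideriv (fun t => g t + h t) x = antideriv g x + antideriv h x := by
  rw [antideriv, antideriv, antideriv, ← integral_add (integrable_unitInterval (by fun_prop))
    (integrable_unitInterval (by fun_prop))]
  congr 1
  ext t
  simp only [smul_add]
  abel

theorem antideriv_const_mul (c : ℝ) (g : Set.Icc (0 : ℝ) 1 → ℝ) (x : Set.Icc (0 : ℝ) 1) :
    antideriv (fun t => c * g t) x = c * antideriv g x := by
  rw [antideriv, antideriv, ← integral_const_mul]
  congr 1
  ext t
  simp only [smul_eq_mul]
  ring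

theorem continuous_antideriv_param {A : Set.Icc (0 : ℝ) 1 → Set.Icc (0 : ℝ) 1 → E}
    (hA : Continuous fun p : Set.Icc (0 : ℝ) 1 × Set.Icc (0 : ℝ) 1 => A p.1 p.2)
    (x : Set.Icc (0 : ℝ) 1) : Continuous fun t => antideriv (A t) x := by
  have h : Continuous (Function.uncurry fun t s : unitInterval =>
      (x : ℝ) • A t (x * s) - (1 - (s : ℝ)) • A t s) := by
    have h1 : Continuous fun p : unitInterval × unitInterval => A p.1 (x * p.2) :=
      hA.comp (f := fun p : unitInterval × unitInterval => (p.1, x * p.2)) (by fun_prop)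
    have h2 : Continuous fun p : unitInterval × unitInterval => (1 - (p.2 : ℝ)) := by fun_prop
    exact (h1.const_smul (x : ℝ)).sub (h2.smul hA)
  simpa [antideriv] using
    continuous_parametric_integral_of_continuous (μ := volume) h isCompact_univ

theorem abs_antideriv_le {g : Set.Icc (0 : ℝ) 1 → ℝ} {M : ℝ} (hM : ∀ t, |g t| ≤ M)
    (x : Set.Icc (0 : ℝ) 1) : |antideriv g x| ≤ 2 * M := by
  have := norm_integral_le_of_norm_le_const (μ := (volume : Measure unitInterval)) (C := 2 * M)
    (f := fun t => (x : ℝ) • g (x * t) - (1 - (t : ℝ)) • g t) (.of_forall fun t => ?_)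
  · simpa [antideriv] using this
  · have hx := x.2
    have ht := t.2
    refine (norm_sub_le _ _).trans ?_
    rw [norm_smul, norm_smul, Real.norm_of_nonneg hx.1, Real.norm_of_nonneg (sub_nonneg.2 ht.2)]
    have h1 := mul_le_of_le_one_left (abs_nonneg (g (x * t))) hx.2
    have h2 := mul_le_of_le_one_left (abs_nonneg (g t)) (sub_le_self 1 ht.1)
    rw [Real.norm_eq_abs, Real.norm_eq_abs]
    linarith [hM (x * t), hM t]

theorem antideriv_tsum {b : ℕ → ℝ} (hb : Summable b) {u : ℕ → Set.Icc (0 : ℝ) 1 → ℝ}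
    (hu : ∀ i, Continuous (u i)) (hu1 : ∀ i t, |u i t| ≤ 1) (x : Set.Icc (0 : ℝ) 1) :
    antideriv (fun t => ∑' i, b i * u i t) x = ∑' i, b i * antideriv (u i) x := by
  have hs : ∀ t, Summable fun i => b i * u i t := fun t =>
    Summable.of_norm_bounded hb.abs fun i => by
      rw [norm_mul, Real.norm_eq_abs, Real.norm_eq_abs]
      exact mul_le_of_le_one_right (abs_nonneg _) (hu1 i t)
  have hF : ∀ i, Continuous fun t : unitInterval =>
      (x : ℝ) • (b i * u i (x * t)) - (1 - (t : ℝ)) • (b i * u i t) := fun i => by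
    have := hu i
    fun_prop
  have hle : ∀ i (t : unitInterval),
      ‖(x : ℝ) • (b i * u i (x * t)) - (1 - (t : ℝ)) • (b i * u i t)‖ ≤ 2 * |b i| := fun i t => by
    have hx := x.2
    have ht := t.2
    refine (norm_sub_le _ _).trans ?_
    simp only [norm_smul, norm_mul]
    rw [Real.norm_of_nonneg hx.1, Real.norm_of_nonneg (sub_nonneg.2 ht.2)]
    simp only [Real.norm_eq_abs]
    have h1 := mul_le_of_le_one_right (abs_nonneg (b i)) (hu1 i (x * t))
    have h2 := mul_le_of_le_one_right (abs_nonneg (b i)) (hu1 i t)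
    have h3 := mul_le_of_le_one_left (by positivity : 0 ≤ |b i| * |u i (x * t)|) hx.2
    have h4 := mul_le_of_le_one_left (by positivity : 0 ≤ |b i| * |u i t|)
      (sub_le_self 1 ht.1)
    linarith
  have key := hasSum_integral_of_summable_integral_norm (μ := (volume : Measure unitInterval))
    (F := fun i t => (x : ℝ) • (b i * u i (x * t)) - (1 - (t : ℝ)) • (b i * u i t))
    (fun i => integrable_unitInterval (hF i))
    (Summable.of_nonneg_of_le (fun i => integral_nonneg fun t => norm_nonneg _)
      (fun i => (integral_mono (integrable_unitInterval (hF i).norm) (integrable_const (2 * |b i|))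
        (hle i)).trans (by simp)) (hb.abs.mul_left 2))
  have h1 : ∀ i, ∫ t : unitInterval, ((x : ℝ) • (b i * u i (x * t)) - (1 - (t : ℝ)) • (b i * u i t))
      = b i * antideriv (u i) x := fun i => antideriv_const_mul (b i) (u i) x
  simp only [h1] at key
  rw [key.tsum_eq, antideriv]
  congr 1
  ext t
  rw [← tsum_const_smul'', ← tsum_const_smul'', Summable.tsum_sub ((hs _).const_smul _)
    ((hs _).const_smul _)]

theorem antideriv_of_hasDerivAt {G g : ℝ → ℝ} (hG : ∀ x, HasDerivAt G (g x) x)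
    (hg : Continuous g) (x : Set.Icc (0 : ℝ) 1) :
    antideriv (fun t => g t) x = G x - ∫ t in (0 : ℝ)..1, G t := by
  have hGc : Continuous G := continuous_iff_continuousAt.2 fun x => (hG x).continuousAt
  have h1 : antideriv (fun t => g t) x =
      ∫ t in (0 : ℝ)..1, ((x : ℝ) * g (x * t) - (1 - t) * g t) := by
    rw [← integral_unitInterval fun t => (x : ℝ) * g (x * t) - (1 - t) * g t]
    rfl
  -- The derivative of `G(xt) - (1 - t) G(t)` is the integrand of `antideriv` plus `G(t)`; the
  -- boundary values leave `G(x)`.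
  have h2 : ∀ t ∈ Set.uIcc (0 : ℝ) 1, HasDerivAt (fun t => G (x * t) - (1 - t) * G t)
      ((x : ℝ) * g (x * t) - (1 - t) * g t + G t) t := fun t _ => by
    have a1 : HasDerivAt (fun t => G (x * t)) (g (x * t) * (x * 1)) t :=
      (hG (x * t)).comp t ((hasDerivAt_id t).const_mul (x : ℝ))
    have a2 := ((hasDerivAt_id t).const_sub 1).mul (hG t)
    refine (a1.sub a2).congr_deriv ?_
    simp only [id]
    ring
  have h3 := intervalIntegral.integral_eq_sub_of_hasDerivAt h2
    (Continuous.intervalIntegrable (by fun_prop) _ _)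
  rw [intervalIntegral.integral_add (Continuous.intervalIntegrable (by fun_prop) _ _)
    (hGc.intervalIntegrable _ _), ← h1] at h3
  simp at h3
  linarith

end antideriv

/-! ### Antiderivatives of kernels in both variables -/

/-- `antideriv` applied in both variables of a kernel. -/
def antideriv₂ (A : Matrix (Set.Icc (0 : ℝ) 1) (Set.Icc (0 : ℝ) 1) ℝ) :
    Matrix (Set.Icc (0 : ℝ) 1) (Set.Icc (0 : ℝ) 1) ℝ :=
  Matrix.of fun x y => antideriv (fun t => antideriv (A t) x) y

/-- Joint continuity of a kernel on the unit square. -/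
def ContKernel (A : Matrix (Set.Icc (0 : ℝ) 1) (Set.Icc (0 : ℝ) 1) ℝ) : Prop :=
  Continuous fun p : Set.Icc (0 : ℝ) 1 × Set.Icc (0 : ℝ) 1 => A p.1 p.2

namespace ContKernel

variable {A B : Matrix (Set.Icc (0 : ℝ) 1) (Set.Icc (0 : ℝ) 1) ℝ}

theorem add (hA : ContKernel A) (hB : ContKernel B) : ContKernel (A + B) :=
  Continuous.add hA hB

theorem smul (c : ℝ) (hA : ContKernel A) : ContKernel (c • A) :=
  Continuous.const_smul hA c

theorem apply_left (hA : ContKernel A) (t : Set.Icc (0 : ℝ) 1) : Continuous (A t) :=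
  hA.comp (Continuous.prodMk_right t)

theorem antideriv₂_add (hA : ContKernel A) (hB : ContKernel B) :
    antideriv₂ (A + B) = antideriv₂ A + antideriv₂ B := by
  ext x y
  have h : ∀ t, antideriv ((A + B) t) x = antideriv (A t) x + antideriv (B t) x := fun t =>
    antideriv_add (hA.apply_left t) (hB.apply_left t) x
  simp only [antideriv₂, Matrix.of_apply, Matrix.add_apply, h]
  exact antideriv_add (continuous_antideriv_param hA x) (continuous_antideriv_param hB x) y

/-- A continuous positive semidefinite kernel is the Gram matrix of its sections, a continuous curve
in `H(A)`. Integrating that curve and pulling the integrals out of the inner product shows that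
`antideriv₂ A` is again a Gram matrix. -/
theorem posSemidef_antideriv₂ (hA : ContKernel A) (hp : A.PosSemidef) :
    (antideriv₂ A).PosSemidef := by
  let K : RKernel (Set.Icc (0 : ℝ) 1) := ⟨A, hp⟩
  have hΦ : Continuous K.ker := by
    rw [continuous_iff_continuousAt]
    intro s
    rw [ContinuousAt, tendsto_iff_norm_sub_tendsto_zero]
    have e : ∀ t, ‖K.ker t - K.ker s‖ = √(A t t - 2 * A t s + A s s) := fun t => by
      have : ‖K.ker t - K.ker s‖ ^ 2 = A t t - 2 * A t s + A s s := by
        rw [norm_sub_sq_real, ← real_inner_self_eq_norm_sq, ← real_inner_self_eq_norm_sq,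
          K.inner_ker_ker, K.inner_ker_ker, K.inner_ker_ker]
      rw [← this, sqrt_sq (norm_nonneg _)]
    simp only [e]
    have hc : Continuous fun t => √(A t t - 2 * A t s + A s s) := by
      have h1 : Continuous fun t => A t t := hA.comp (continuous_id.prodMk continuous_id)
      have h2 : Continuous fun t => A t s := hA.comp (Continuous.prodMk_left s)
      exact ((h1.sub (h2.const_mul 2)).add continuous_const).sqrt
    have := hc.tendsto s
    convert this using 2
    rw [eq_comm, sqrt_eq_zero']
    linarith
  convert gram_posSemidef (antideriv K.ker) using 1
  ext x y
  rw [Matrix.of_apply, inner_antideriv hΦ]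
  change antideriv (fun t => antideriv (A t) x) y = _
  refine congrArg (fun g : Set.Icc (0 : ℝ) 1 → ℝ => antideriv g y) (funext fun t => ?_)
  rw [real_inner_comm, inner_antideriv hΦ]
  exact congrArg (fun g : Set.Icc (0 : ℝ) 1 → ℝ => antideriv g x)
    (funext fun s => (K.inner_ker_ker t s).symm)

end ContKernel

theorem antideriv₂_smul (c : ℝ) (A : Matrix (Set.Icc (0 : ℝ) 1) (Set.Icc (0 : ℝ) 1) ℝ) :
    antideriv₂ (c • A) = c • antideriv₂ A := by
  ext x y
  have h : ∀ t, antideriv ((c • A) t) x = c * antideriv (A t) x := fun t =>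
    antideriv_const_mul c (A t) x
  simp only [antideriv₂, Matrix.of_apply, Matrix.smul_apply, h, antideriv_const_mul, smul_eq_mul]

theorem Dominated.antideriv₂ {A B : Matrix (Set.Icc (0 : ℝ) 1) (Set.Icc (0 : ℝ) 1) ℝ}
    (hA : ContKernel A) (hB : ContKernel B) (h : Dominated A B) :
    Dominated (antideriv₂ A) (antideriv₂ B) := by
  obtain ⟨c, hc, h⟩ := h
  refine ⟨c, hc, ?_⟩
  have e : c • B - A = c • B + (-1 : ℝ) • A := by simp [sub_eq_add_neg]
  have h2 := ((hB.smul c).add (hA.smul (-1))).posSemidef_antideriv₂ (e ▸ h)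
  rwa [(hB.smul c).antideriv₂_add (hA.smul (-1)), antideriv₂_smul, antideriv₂_smul, neg_one_smul,
    ← sub_eq_add_neg] at h2

theorem antideriv₂_rankOne (u : Set.Icc (0 : ℝ) 1 → ℝ) :
    antideriv₂ (Matrix.of fun s t => u s * u t) =
      Matrix.of fun x y => antideriv u x * antideriv u y := by
  ext x y
  have h : ∀ t, antideriv ((Matrix.of fun s t => u s * u t) t) x = antideriv u x * u t := fun t =>
    (antideriv_const_mul (u t) u x).trans (mul_comm _ _)
  simp only [antideriv₂, Matrix.of_apply, h, antideriv_const_mul]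

theorem contKernel_rankOne {u : Set.Icc (0 : ℝ) 1 → ℝ} (hu : Continuous u) :
    ContKernel (Matrix.of fun s t => u s * u t) := by
  unfold ContKernel
  simp only [Matrix.of_apply]
  fun_prop

/-! ### Termwise integration of trigonometric series -/

section Series

variable {a : ℕ → ℝ} {u : ℕ → Set.Icc (0 : ℝ) 1 → ℝ}

theorem summable_series (ha : Summable a) (hu1 : ∀ i t, |u i t| ≤ 1)
    (s t : Set.Icc (0 : ℝ) 1) : Summable fun i => a i * (u i s * u i t) :=
  Summable.of_norm_bounded ha.abs fun i => by
    rw [norm_mul, norm_mul]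
    exact mul_le_of_le_one_right (abs_nonneg _)
      (mul_le_one₀ (hu1 i s) (abs_nonneg _) (hu1 i t))

theorem contKernel_series (ha : Summable a) (hu1 : ∀ i t, |u i t| ≤ 1)
    (hu : ∀ i, Continuous (u i)) :
    ContKernel (Matrix.of fun s t => ∑' i, a i * (u i s * u i t)) := by
  refine continuous_tsum (fun i => ?_) ha.abs fun i p => ?_
  · have := hu i
    fun_prop
  · rw [norm_mul, norm_mul]
    exact mul_le_of_le_one_right (abs_nonneg _)
      (mul_le_one₀ (hu1 i _) (abs_nonneg _) (hu1 i _))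

theorem antideriv₂_series (ha : Summable a) (hu1 : ∀ i t, |u i t| ≤ 1)
    (hu : ∀ i, Continuous (u i)) :
    antideriv₂ (Matrix.of fun s t => ∑' i, a i * (u i s * u i t)) =
      Matrix.of fun x y => ∑' i, a i * (antideriv (u i) x * antideriv (u i) y) := by
  ext x y
  have h : ∀ t, antideriv ((Matrix.of fun s t => ∑' i, a i * (u i s * u i t)) t) x =
      ∑' i, a i * antideriv (u i) x * u i t := fun t => by
    have := antideriv_tsum (b := fun i => a i * u i t) (Summable.of_norm_bounded ha.abs fun i => by
      rw [norm_mul]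
      exact mul_le_of_le_one_right (abs_nonneg _) (hu1 i t)) hu hu1 x
    simp only [mul_assoc] at this
    refine this.trans (tsum_congr fun i => by ring)
  simp only [antideriv₂, Matrix.of_apply, h]
  rw [antideriv_tsum (Summable.of_norm_bounded (ha.abs.mul_right 2) fun i => ?_) hu hu1]
  · exact tsum_congr fun i => by ring
  · rw [norm_mul]
    exact mul_le_mul_of_nonneg_left ((abs_antideriv_le (hu1 i) x).trans (by norm_num))
      (abs_nonneg _)

end Series

theorem antideriv_cos {c : ℝ} (hc : c ≠ 0) (x : Set.Icc (0 : ℝ) 1) :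
    antideriv (fun t => cos (c * t)) x = sin (c * x) / c - (1 - cos c) / c ^ 2 := by
  have hG : ∀ x, HasDerivAt (fun x => sin (c * x) / c) (cos (c * x)) x := fun x => by
    have := ((hasDerivAt_sin (c * x)).comp x ((hasDerivAt_id x).const_mul c)).div_const c
    refine this.congr_deriv ?_
    field_simp
  rw [antideriv_of_hasDerivAt hG (by fun_prop), intervalIntegral.integral_div,
    intervalIntegral.integral_comp_mul_left (fun t => sin t) hc]
  simp only [integral_sin, mul_zero, mul_one, cos_zero, smul_eq_mul]
  field_simp

theorem antideriv_sin {c : ℝ} (hc : c ≠ 0) (x : Set.Icc (0 : ℝ) 1) :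
    antideriv (fun t => sin (c * t)) x = sin c / c ^ 2 - cos (c * x) / c := by
  have hG : ∀ x, HasDerivAt (fun x => -cos (c * x) / c) (sin (c * x)) x := fun x => by
    have := ((hasDerivAt_cos (c * x)).comp x ((hasDerivAt_id x).const_mul c)).neg.div_const c
    refine this.congr_deriv ?_
    field_simp
  rw [antideriv_of_hasDerivAt hG (by fun_prop), intervalIntegral.integral_div,
    intervalIntegral.integral_neg, intervalIntegral.integral_comp_mul_left (fun t => cos t) hc]
  simp only [integral_cos, mul_zero, mul_one, sin_zero, smul_eq_mul]
  field_simp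
  ring

/-- `∑ₖ k^{-2α} cos(βkx) cos(βky)`. -/
def cosSeries (β : ℝ) (α : ℕ) : Matrix (Set.Icc (0 : ℝ) 1) (Set.Icc (0 : ℝ) 1) ℝ :=
  Matrix.of fun x y => ∑' k : ℕ, 1 / ((k : ℝ) + 1) ^ (2 * α) *
    (cos (β * ((k : ℝ) + 1) * x) * cos (β * ((k : ℝ) + 1) * y))

/-- `∑ₖ k^{-2α} sin(βkx) sin(βky)`. -/
def sinSeries (β : ℝ) (α : ℕ) : Matrix (Set.Icc (0 : ℝ) 1) (Set.Icc (0 : ℝ) 1) ℝ :=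
  Matrix.of fun x y => ∑' k : ℕ, 1 / ((k : ℝ) + 1) ^ (2 * α) *
    (sin (β * ((k : ℝ) + 1) * x) * sin (β * ((k : ℝ) + 1) * y))

/-- The kernel which is constantly one. -/
def oneKernel : Matrix (Set.Icc (0 : ℝ) 1) (Set.Icc (0 : ℝ) 1) ℝ := Matrix.of fun _ _ => 1

/-- The rank one kernel of the normalised Bernoulli polynomial of degree `τ`. -/
def bernoulliKernel (τ : ℕ) : Matrix (Set.Icc (0 : ℝ) 1) (Set.Icc (0 : ℝ) 1) ℝ :=
  Matrix.of fun x y => bernoulliFun τ x / (τ.factorial : ℝ) * (bernoulliFun τ y / τ.factorial)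

/-- The part of the kernel of the unanchored Sobolev space with weight one which belongs to the
functions of mean value zero. -/
def sobMeanZero (α : ℕ) : Matrix (Set.Icc (0 : ℝ) 1) (Set.Icc (0 : ℝ) 1) ℝ :=
  ∑ τ ∈ Finset.range α, bernoulliKernel (τ + 1) +
    (2 / (2 * π) ^ (2 * α)) • (cosSeries (2 * π) α + sinSeries (2 * π) α)

theorem summable_one_div_succ_pow {α : ℕ} (hα : 1 ≤ α) :
    Summable fun k : ℕ => 1 / ((k : ℝ) + 1) ^ (2 * α) := by
  have := (summable_nat_add_iff 1).2 (Real.summable_one_div_nat_pow.2 (by omega : 1 < 2 * α))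
  simpa using this

theorem summable_cosSeries (β : ℝ) {α : ℕ} (hα : 1 ≤ α) (x y : Set.Icc (0 : ℝ) 1) :
    Summable fun k : ℕ => 1 / ((k : ℝ) + 1) ^ (2 * α) *
      (cos (β * ((k : ℝ) + 1) * x) * cos (β * ((k : ℝ) + 1) * y)) :=
  summable_series (u := fun k x => cos (β * ((k : ℝ) + 1) * x)) (summable_one_div_succ_pow hα)
    (fun _ _ => abs_cos_le_one _) x y

theorem summable_sinSeries (β : ℝ) {α : ℕ} (hα : 1 ≤ α) (x y : Set.Icc (0 : ℝ) 1) :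
    Summable fun k : ℕ => 1 / ((k : ℝ) + 1) ^ (2 * α) *
      (sin (β * ((k : ℝ) + 1) * x) * sin (β * ((k : ℝ) + 1) * y)) :=
  summable_series (u := fun k x => sin (β * ((k : ℝ) + 1) * x)) (summable_one_div_succ_pow hα)
    (fun _ _ => abs_sin_le_one _) x y

theorem contKernel_cosSeries (β : ℝ) {α : ℕ} (hα : 1 ≤ α) : ContKernel (cosSeries β α) :=
  contKernel_series (u := fun k x => cos (β * ((k : ℝ) + 1) * x)) (summable_one_div_succ_pow hα)
    (fun _ _ => abs_cos_le_one _) fun _ => by fun_prop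

theorem contKernel_sinSeries (β : ℝ) {α : ℕ} (hα : 1 ≤ α) : ContKernel (sinSeries β α) :=
  contKernel_series (u := fun k x => sin (β * ((k : ℝ) + 1) * x)) (summable_one_div_succ_pow hα)
    (fun _ _ => abs_sin_le_one _) fun _ => by fun_prop

theorem posSemidef_cosSeries (β : ℝ) {α : ℕ} (hα : 1 ≤ α) : (cosSeries β α).PosSemidef :=
  posSemidef_of_hasSum (fun k : ℕ => posSemidef_rankOne (1 / ((k : ℝ) + 1) ^ (2 * α))
    (by positivity) fun x : Set.Icc (0 : ℝ) 1 => cos (β * ((k : ℝ) + 1) * x))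
    fun x y => (summable_cosSeries β hα x y).hasSum

theorem posSemidef_sinSeries (β : ℝ) {α : ℕ} (hα : 1 ≤ α) : (sinSeries β α).PosSemidef :=
  posSemidef_of_hasSum (fun k : ℕ => posSemidef_rankOne (1 / ((k : ℝ) + 1) ^ (2 * α))
    (by positivity) fun x : Set.Icc (0 : ℝ) 1 => sin (β * ((k : ℝ) + 1) * x))
    fun x y => (summable_sinSeries β hα x y).hasSum

theorem antideriv₂_cosSeries {β : ℝ} (hβ : β ≠ 0) {α : ℕ} (hα : 1 ≤ α) :
    antideriv₂ (cosSeries β α) = Matrix.of fun x y : Set.Icc (0 : ℝ) 1 =>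
      ∑' k : ℕ, 1 / ((k : ℝ) + 1) ^ (2 * α) *
        ((sin (β * ((k : ℝ) + 1) * x) / (β * ((k : ℝ) + 1)) -
          (1 - cos (β * ((k : ℝ) + 1))) / (β * ((k : ℝ) + 1)) ^ 2) *
        (sin (β * ((k : ℝ) + 1) * y) / (β * ((k : ℝ) + 1)) -
          (1 - cos (β * ((k : ℝ) + 1))) / (β * ((k : ℝ) + 1)) ^ 2)) := by
  refine (antideriv₂_series (u := fun k x => cos (β * ((k : ℝ) + 1) * x))
    (summable_one_div_succ_pow hα) (fun _ _ => abs_cos_le_one _) fun _ => by fun_prop).trans ?_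
  have h : ∀ k : ℕ, β * ((k : ℝ) + 1) ≠ 0 := fun k => mul_ne_zero hβ (by positivity)
  simp only [antideriv_cos (h _)]

/-- The condition `hs` makes the cosine antiderivatives mean-free already, so no correction appears.
-/
theorem antideriv₂_sinSeries {β : ℝ} (hβ : β ≠ 0) {α : ℕ} (hα : 1 ≤ α)
    (hs : ∀ k : ℕ, sin (β * ((k : ℝ) + 1)) = 0) :
    antideriv₂ (sinSeries β α) = (β ^ 2)⁻¹ • cosSeries β (α + 1) := by
  refine (antideriv₂_series (u := fun k x => sin (β * ((k : ℝ) + 1) * x))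
    (summable_one_div_succ_pow hα) (fun _ _ => abs_sin_le_one _) fun _ => by fun_prop).trans ?_
  have h : ∀ k : ℕ, β * ((k : ℝ) + 1) ≠ 0 := fun k => mul_ne_zero hβ (by positivity)
  ext x y
  simp only [antideriv_sin (h _), hs, cosSeries, Matrix.of_apply, Matrix.smul_apply, smul_eq_mul,
    ← tsum_mul_left]
  refine tsum_congr fun k => ?_
  field_simp
  ring

theorem antideriv₂_cosSeries_of_cos_eq_one {β : ℝ} (hβ : β ≠ 0) {α : ℕ} (hα : 1 ≤ α)
    (hs : ∀ k : ℕ, cos (β * ((k : ℝ) + 1)) = 1) :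
    antideriv₂ (cosSeries β α) = (β ^ 2)⁻¹ • sinSeries β (α + 1) := by
  rw [antideriv₂_cosSeries hβ hα]
  ext x y
  simp only [hs, sinSeries, Matrix.of_apply, Matrix.smul_apply, smul_eq_mul, ← tsum_mul_left]
  refine tsum_congr fun k => ?_
  field_simp
  ring

/-- For the half period the antiderivatives `u k` of the cosines have nonzero means `m k`. Since `u
= (u - m) + m`, the kernel of `u` is at most twice the kernel of `u - m` plus twice that of `m`; the
latter sums to the constant kernel `2κ`. -/
theorem Dominated.sinSeries_succ {β : ℝ} (hβ : β ≠ 0) {α : ℕ} (hα : 1 ≤ α)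
    {B : Matrix (Set.Icc (0 : ℝ) 1) (Set.Icc (0 : ℝ) 1) ℝ} (h1 : Dominated oneKernel B)
    (h2 : Dominated (RKSpaces.antideriv₂ (cosSeries β α)) B) :
    Dominated (sinSeries β (α + 1)) B := by
  set u : ℕ → ℝ → ℝ := fun k x => sin (β * ((k : ℝ) + 1) * x) / (β * ((k : ℝ) + 1)) with hu
  set m : ℕ → ℝ := fun k => (1 - cos (β * ((k : ℝ) + 1))) / (β * ((k : ℝ) + 1)) ^ 2 with hm
  set a : ℕ → ℝ := fun k => 1 / ((k : ℝ) + 1) ^ (2 * α) with ha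
  have hβ2 : 0 < β ^ 2 := by positivity
  have hle : ∀ k : ℕ, β ^ 2 ≤ (β * ((k : ℝ) + 1)) ^ 2 := fun k => by
    rw [mul_pow]
    refine le_mul_of_one_le_right hβ2.le (one_le_pow₀ ?_)
    linarith [k.cast_nonneg (α := ℝ)]
  have hm1 : ∀ k, |m k| ≤ 2 / β ^ 2 := fun k => by
    have hc1 := cos_le_one (β * ((k : ℝ) + 1))
    have hc2 := neg_one_le_cos (β * ((k : ℝ) + 1))
    rw [hm, abs_of_nonneg (div_nonneg (by linarith) (sq_nonneg _))]
    exact div_le_div₀ (by norm_num) (by linarith) hβ2 (hle k)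
  have hu1 : ∀ k x, |u k x| ≤ 1 / |β| := fun k x => by
    rw [hu, abs_div]
    refine div_le_div₀ (by norm_num) (abs_sin_le_one _) (abs_pos.2 hβ) ?_
    exact (sq_le_sq.1 (hle k))
  have hsum : ∀ (v w : ℕ → ℝ) (C D : ℝ), (∀ k, |v k| ≤ C) → (∀ k, |w k| ≤ D) →
      Summable fun k => a k * (v k * w k) := fun v w C D hv hw => by
    refine Summable.of_norm_bounded ((summable_one_div_succ_pow hα).mul_right (C * D)) fun k => ?_
    rw [norm_mul, norm_mul, Real.norm_of_nonneg (by positivity : 0 ≤ a k)]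
    exact mul_le_mul_of_nonneg_left (mul_le_mul (hv k) (hw k) (abs_nonneg _)
      ((abs_nonneg _).trans (hv k))) (by positivity)
  set κ : ℝ := ∑' k, a k * (m k * m k) with hκ
  have hκ0 : 0 ≤ κ := tsum_nonneg fun k => mul_nonneg (by positivity) (mul_self_nonneg _)
  have hum : ∀ (x : ℝ) k, |u k x - m k| ≤ 1 / |β| + 2 / β ^ 2 := fun x k =>
    (abs_sub _ _).trans (add_le_add (hu1 k x) (hm1 k))
  have key : ((2 : ℝ) • RKSpaces.antideriv₂ (cosSeries β α) + (2 * κ) • oneKernel -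
      (β ^ 2)⁻¹ • sinSeries β (α + 1)).PosSemidef := by
    -- Writing `f f` for `f(x) f(y)`: `2(u - m)(u - m) + 2mm - uu = (u - 2m)(u - 2m)`.
    refine posSemidef_of_hasSum (fun k => posSemidef_rankOne (a k) (by positivity)
      fun x : Set.Icc (0 : ℝ) 1 => u k x - 2 * m k) fun x y => ?_
    have s1 := (hsum _ _ _ _ (hum x) (hum y)).hasSum.mul_left 2
    have s2 := (hsum _ _ _ _ hm1 hm1).hasSum.mul_left 2
    have s3 := (summable_sinSeries β (by omega : 1 ≤ α + 1) x y).hasSum.mul_left (β ^ 2)⁻¹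
    have hv : ((2 : ℝ) • RKSpaces.antideriv₂ (cosSeries β α) + (2 * κ) • oneKernel -
        (β ^ 2)⁻¹ • sinSeries β (α + 1)) x y =
        2 * ∑' k, a k * ((u k x - m k) * (u k y - m k)) + 2 * κ -
          (β ^ 2)⁻¹ * sinSeries β (α + 1) x y := by
      rw [antideriv₂_cosSeries hβ hα]
      simp only [Matrix.sub_apply, Matrix.add_apply, Matrix.smul_apply, smul_eq_mul, oneKernel,
        Matrix.of_apply, mul_one]
      rfl
    rw [hv]
    refine ((s1.add s2).sub s3).congr_fun fun k => ?_
    have : (1 : ℝ) / ((k : ℝ) + 1) ^ (2 * (α + 1)) = a k / ((k : ℝ) + 1) ^ 2 := by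
      rw [ha]; field_simp; ring
    have e : (β ^ 2)⁻¹ * (a k / ((k : ℝ) + 1) ^ 2 * (sin (β * ((k : ℝ) + 1) * x) *
        sin (β * ((k : ℝ) + 1) * y))) = a k * (u k x * u k y) := by
      rw [hu]; field_simp
    rw [this, e, Matrix.of_apply]
    ring
  have hd := (Dominated.of_posSemidef_sub key).trans
    ((h2.smul (by norm_num : (0 : ℝ) ≤ 2)).add (h1.smul (by positivity : 0 ≤ 2 * κ)))
  exact (Dominated.smul_right (inv_pos.2 hβ2) _).trans hd

/-! ### Bernoulli kernels and the Sobolev recursion -/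

theorem continuous_bernoulliFun_coe (τ : ℕ) :
    Continuous fun x : Set.Icc (0 : ℝ) 1 => bernoulliFun τ x / (τ.factorial : ℝ) :=
  ((continuous_bernoulliFun τ).comp continuous_subtype_val).div_const _

theorem contKernel_bernoulliKernel (τ : ℕ) : ContKernel (bernoulliKernel τ) :=
  contKernel_rankOne (continuous_bernoulliFun_coe τ)

theorem posSemidef_bernoulliKernel (τ : ℕ) : (bernoulliKernel τ).PosSemidef := by
  unfold bernoulliKernel
  simpa using posSemidef_rankOne 1 one_pos.le
    fun x : Set.Icc (0 : ℝ) 1 => bernoulliFun τ x / (τ.factorial : ℝ)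

theorem oneKernel_eq : oneKernel = bernoulliKernel 0 := by
  ext x y
  simp [oneKernel, bernoulliKernel]

theorem antideriv₂_bernoulliKernel (τ : ℕ) :
    antideriv₂ (bernoulliKernel τ) = bernoulliKernel (τ + 1) := by
  have hG : ∀ x, HasDerivAt (fun x => bernoulliFun (τ + 1) x / ((τ + 1).factorial : ℝ))
      (bernoulliFun τ x / (τ.factorial : ℝ)) x := fun x => by
    refine ((hasDerivAt_bernoulliFun (τ + 1) x).div_const _).congr_deriv ?_
    rw [Nat.factorial_succ]
    push_cast
    have : (τ.factorial : ℝ) ≠ 0 := by positivity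
    field_simp
  rw [bernoulliKernel, antideriv₂_rankOne]
  ext x y
  simp only [antideriv_of_hasDerivAt hG ((continuous_bernoulliFun τ).div_const _),
    intervalIntegral.integral_div, integral_bernoulliFun_eq_zero τ.succ_ne_zero, bernoulliKernel,
    Matrix.of_apply]
  simp

theorem contKernel_sum_bernoulliKernel (n i : ℕ) :
    ContKernel (∑ τ ∈ Finset.range n, bernoulliKernel (τ + i)) := by
  induction n with
  | zero => simpa [ContKernel] using continuous_const
  | succ n ih =>
    rw [Finset.sum_range_succ]
    exact ih.add (contKernel_bernoulliKernel _)

theorem antideriv₂_sum_bernoulliKernel (n i : ℕ) :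
    antideriv₂ (∑ τ ∈ Finset.range n, bernoulliKernel (τ + i)) =
      ∑ τ ∈ Finset.range n, bernoulliKernel (τ + i + 1) := by
  induction n with
  | zero =>
    have := antideriv₂_smul 0 0
    simpa using this
  | succ n ih =>
    rw [Finset.sum_range_succ, Finset.sum_range_succ,
      (contKernel_sum_bernoulliKernel n i).antideriv₂_add (contKernel_bernoulliKernel _), ih,
      antideriv₂_bernoulliKernel]

theorem contKernel_sobMeanZero {α : ℕ} (hα : 1 ≤ α) : ContKernel (sobMeanZero α) :=
  (contKernel_sum_bernoulliKernel α 1).add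
    (((contKernel_cosSeries _ hα).add (contKernel_sinSeries _ hα)).smul _)

theorem posSemidef_sobMeanZero {α : ℕ} (hα : 1 ≤ α) : (sobMeanZero α).PosSemidef :=
  (Matrix.posSemidef_sum _ fun τ _ => posSemidef_bernoulliKernel (τ + 1)).add
    (((posSemidef_cosSeries _ hα).add (posSemidef_sinSeries _ hα)).smul
      (by positivity : 0 ≤ 2 / (2 * π) ^ (2 * α)))

/-- Integration raises each Bernoulli degree by one, with the constant `B_0` supplying the new
degree `1` term. In the periodic part sine and cosine swap and gain the factor `(2π)⁻²`. -/
theorem antideriv₂_sob {α : ℕ} (hα : 1 ≤ α) :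
    antideriv₂ (oneKernel + sobMeanZero α) = sobMeanZero (α + 1) := by
  have hπ : 2 * π ≠ 0 := by positivity
  have hcs := (contKernel_cosSeries (2 * π) hα).add (contKernel_sinSeries (2 * π) hα)
  have hc : ∀ k : ℕ, cos (2 * π * ((k : ℝ) + 1)) = 1 := fun k => by
    refine (congrArg cos ?_).trans (cos_nat_mul_two_pi (k + 1))
    push_cast
    ring
  have hs : ∀ k : ℕ, sin (2 * π * ((k : ℝ) + 1)) = 0 := fun k => by
    refine (congrArg sin ?_).trans (sin_nat_mul_pi (2 * (k + 1)))
    push_cast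
    ring
  rw [oneKernel_eq, (contKernel_bernoulliKernel 0).antideriv₂_add (contKernel_sobMeanZero hα),
    sobMeanZero, (contKernel_sum_bernoulliKernel α 1).antideriv₂_add (hcs.smul _),
    antideriv₂_smul, (contKernel_cosSeries (2 * π) hα).antideriv₂_add
      (contKernel_sinSeries (2 * π) hα), antideriv₂_sinSeries hπ hα hs,
    antideriv₂_cosSeries_of_cos_eq_one hπ hα hc, antideriv₂_sum_bernoulliKernel,
    antideriv₂_bernoulliKernel, sobMeanZero, Finset.sum_range_succ', ← smul_add, smul_smul,
    add_comm (sinSeries _ _)]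
  have : 2 / (2 * π) ^ (2 * α) * ((2 * π) ^ 2)⁻¹ = 2 / (2 * π) ^ (2 * (α + 1)) := by
    field_simp
    ring
  rw [this]
  abel

/-! ### Closed forms for smoothness one -/

theorem hasSum_cos_bernoulli {α : ℕ} (hα : 1 ≤ α) {u : ℝ} (hu : u ∈ Set.Icc (0 : ℝ) 1) :
    HasSum (fun k : ℕ => 1 / ((k : ℝ) + 1) ^ (2 * α) * cos (2 * π * ((k : ℝ) + 1) * u))
      ((-1 : ℝ) ^ (α + 1) * (2 * π) ^ (2 * α) / 2 / (2 * α).factorial *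
        bernoulliFun (2 * α) u) := by
  have h' : HasSum (fun n : ℕ => 1 / (n : ℝ) ^ (2 * α) * cos (2 * π * n * u))
      ((-1 : ℝ) ^ (α + 1) * (2 * π) ^ (2 * α) / 2 / (2 * α).factorial * bernoulliFun (2 * α) u) :=
    hasSum_one_div_nat_pow_mul_cos (by omega) hu
  have h := (hasSum_nat_add_iff' 1).2 h'
  -- The term `n = 0` is `1 / 0 = 0`, so shifting the index loses nothing.
  have h0 : (0 : ℝ) ^ (2 * α) = 0 := zero_pow (by omega)
  simpa [h0] using h

theorem mem_Icc_abs_sub (x y : Set.Icc (0 : ℝ) 1) : |(x : ℝ) - y| ∈ Set.Icc (0 : ℝ) 1 :=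
  ⟨abs_nonneg _, abs_sub_le_iff.2 ⟨by linarith [x.2.2, y.2.1], by linarith [y.2.2, x.2.1]⟩⟩

theorem cos_mul_abs (c u : ℝ) : cos (c * |u|) = cos (c * u) := by
  rcases abs_choice u with h | h <;> rw [h]
  rw [mul_neg, cos_neg]

theorem cosSeries_add_sinSeries {α : ℕ} (hα : 1 ≤ α) (x y : Set.Icc (0 : ℝ) 1) :
    cosSeries (2 * π) α x y + sinSeries (2 * π) α x y =
      (-1 : ℝ) ^ (α + 1) * (2 * π) ^ (2 * α) / 2 / (2 * α).factorial *
        bernoulliFun (2 * α) |(x : ℝ) - y| := by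
  refine ((summable_cosSeries _ hα x y).hasSum.add (summable_sinSeries _ hα x y).hasSum).unique
    ((hasSum_cos_bernoulli hα (mem_Icc_abs_sub x y)).congr_fun fun k => ?_)
  rw [cos_mul_abs, mul_sub, cos_sub]
  ring

theorem hasSum_cos_half {x : ℝ} (hx : |x| ≤ 2) :
    HasSum (fun k : ℕ => 1 / ((k : ℝ) + 1) ^ 2 * cos (π * ((k : ℝ) + 1) * x))
      (π ^ 2 * ((|x| / 2) ^ 2 - |x| / 2 + 6⁻¹)) := by
  have h := hasSum_cos_bernoulli (α := 1) le_rfl (u := |x| / 2) ⟨by positivity, by linarith⟩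
  convert h.congr_fun fun k => ?_ using 1
  · rw [mul_one, bernoulliFun_two, Nat.factorial_two]
    push_cast
    ring
  · rw [← cos_mul_abs]
    ring_nf

theorem cosSeries_pi_one (x y : Set.Icc (0 : ℝ) 1) : cosSeries π 1 x y =
    π ^ 2 / 2 * (((x : ℝ) ^ 2 + y ^ 2) / 2 - (x + y + |(x : ℝ) - y|) / 2 + 1 / 3) := by
  have hx := x.2
  have hy := y.2
  have h1 := hasSum_cos_half (x := (x : ℝ) - y) ((mem_Icc_abs_sub x y).2.trans (by norm_num))
  have h2 := hasSum_cos_half (x := (x : ℝ) + y) (by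
    rw [abs_of_nonneg (add_nonneg hx.1 hy.1)]; linarith [hx.2, hy.2])
  have h3 : cosSeries π 1 x y = _ := ((summable_cosSeries π le_rfl x y).hasSum.unique
    (((h1.add h2).mul_left 2⁻¹).congr_fun fun k => by
      rw [mul_sub (π * ((k : ℝ) + 1)), mul_add (π * ((k : ℝ) + 1)), cos_sub, cos_add]; ring))
  rw [h3, abs_of_nonneg (add_nonneg hx.1 hy.1)]
  have := sq_abs ((x : ℝ) - y)
  linear_combination π ^ 2 / 8 * this

theorem sinSeries_pi_one (x y : Set.Icc (0 : ℝ) 1) : sinSeries π 1 x y =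
    π ^ 2 / 2 * ((x + y - |(x : ℝ) - y|) / 2 - x * y) := by
  have hx := x.2
  have hy := y.2
  have h1 := hasSum_cos_half (x := (x : ℝ) - y) ((mem_Icc_abs_sub x y).2.trans (by norm_num))
  have h2 := hasSum_cos_half (x := (x : ℝ) + y) (by
    rw [abs_of_nonneg (add_nonneg hx.1 hy.1)]; linarith [hx.2, hy.2])
  have h3 : sinSeries π 1 x y = _ := ((summable_sinSeries π le_rfl x y).hasSum.unique
    (((h1.sub h2).mul_left 2⁻¹).congr_fun fun k => by
      rw [mul_sub (π * ((k : ℝ) + 1)), mul_add (π * ((k : ℝ) + 1)), cos_sub, cos_add]; ring))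
  rw [h3, abs_of_nonneg (add_nonneg hx.1 hy.1)]
  have := sq_abs ((x : ℝ) - y)
  linear_combination π ^ 2 / 8 * this

theorem periodicKernel_one (x y : Set.Icc (0 : ℝ) 1) :
    cosSeries (2 * π) 1 x y + sinSeries (2 * π) 1 x y =
      π ^ 2 * (((x : ℝ) - y) ^ 2 - |(x : ℝ) - y| + 6⁻¹) := by
  rw [cosSeries_add_sinSeries le_rfl, mul_one, bernoulliFun_two, sq_abs, Nat.factorial_two]
  push_cast
  ring

theorem sobMeanZero_one : sobMeanZero 1 = (2 / π ^ 2) • cosSeries π 1 := by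
  ext x y
  have h := periodicKernel_one x y
  simp only [sobMeanZero, Finset.sum_range_one, Matrix.add_apply, Matrix.smul_apply, smul_eq_mul,
    h, cosSeries_pi_one, bernoulliKernel, Matrix.of_apply, zero_add, mul_one, bernoulliFun_one,
    Nat.factorial_one, Nat.cast_one]
  field_simp
  ring

/-! ### The half-period series are dominated by the Sobolev kernel -/

theorem posSemidef_oneKernel : oneKernel.PosSemidef := posSemidef_const_one

theorem dominated_oneKernel {α : ℕ} (hα : 1 ≤ α) :
    Dominated oneKernel (oneKernel + sobMeanZero α) :=
  .add_right (posSemidef_sobMeanZero hα) _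

theorem dominated_periodic_sobMeanZero (α : ℕ) :
    Dominated (cosSeries (2 * π) α + sinSeries (2 * π) α) (sobMeanZero α) :=
  (Dominated.smul_right (by positivity : 0 < 2 / (2 * π) ^ (2 * α)) _).trans
    (.add_left (Matrix.posSemidef_sum _ fun τ _ => posSemidef_bernoulliKernel (τ + 1)) _)

/-- The Brownian bridge kernel comes from increments of the periodic kernel `P`: `4 S_π(x,y) =
P(x,y) - P(x,0) - P(0,y) + P(0,0)`, the Gram matrix of differences of sections. The parallelogram
law bounds it by `2P + 2P(0,0)`, the defect being the Gram matrix of the sums. -/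
theorem dominated_sinSeries_pi_one :
    Dominated (sinSeries π 1) (oneKernel + sobMeanZero 1) := by
  let P := cosSeries (2 * π) 1 + sinSeries (2 * π) 1
  let o : Set.Icc (0 : ℝ) 1 := ⟨0, by norm_num⟩
  have hP : P.PosSemidef := (posSemidef_cosSeries _ le_rfl).add (posSemidef_sinSeries _ le_rfl)
  have hoo : 0 ≤ P o o := by simpa using ((posSemidef_iff_sum _).1 hP).2 {o} 1
  have hsum : (Matrix.of fun x y => P x y + P x o + P o y + P o o).PosSemidef := by
    let K : RKernel (Set.Icc (0 : ℝ) 1) := ⟨P, hP⟩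
    convert gram_posSemidef (fun x => K.ker x + K.ker o) using 1
    ext x y
    simp only [Matrix.of_apply, inner_add_left, inner_add_right, K.inner_ker_ker]
    change P x y + P x o + P o y + P o o = P x y + P o y + (P x o + P o o)
    ring
  have key : ((2 : ℝ) • P + (2 * P o o) • oneKernel - (4 : ℝ) • sinSeries π 1).PosSemidef := by
    convert hsum using 1
    ext x y
    have hxy := periodicKernel_one x y
    have hxo := periodicKernel_one x o
    have hoy := periodicKernel_one o y
    have h00 := periodicKernel_one o o
    simp only [o, sub_zero, zero_sub, abs_neg, abs_of_nonneg x.2.1, abs_of_nonneg y.2.1,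
      abs_zero] at hxo hoy h00
    simp only [P, Matrix.of_apply, Matrix.sub_apply, Matrix.add_apply, Matrix.smul_apply,
      smul_eq_mul, oneKernel, sinSeries_pi_one]
    linear_combination hxy - hxo - hoy + h00
  have h1 : Dominated P (oneKernel + sobMeanZero 1) :=
    (dominated_periodic_sobMeanZero 1).trans (.add_left posSemidef_oneKernel _)
  have h2 := (Dominated.of_posSemidef_sub key).trans ((h1.smul (by norm_num : (0 : ℝ) ≤ 2)).add
    ((dominated_oneKernel le_rfl).smul (by positivity : 0 ≤ 2 * P o o)))
  exact (Dominated.smul_right (by norm_num : (0 : ℝ) < 4) _).trans h2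

theorem dominated_halfPeriod_series {α : ℕ} (hα : 1 ≤ α) :
    Dominated (cosSeries π α) (oneKernel + sobMeanZero α) ∧
      Dominated (sinSeries π α) (oneKernel + sobMeanZero α) := by
  induction α, hα using Nat.le_induction with
  | base =>
    refine ⟨?_, dominated_sinSeries_pi_one⟩
    have := (Dominated.smul_right (by positivity : 0 < 2 / π ^ 2) (cosSeries π 1))
    rw [← sobMeanZero_one] at this
    exact this.trans (.add_left posSemidef_oneKernel _)
  | succ α hα ih =>
    have hs : ∀ k : ℕ, sin (π * ((k : ℝ) + 1)) = 0 := fun k => by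
      have := sin_nat_mul_pi (k + 1)
      push_cast at this
      rw [← this, mul_comm]
    have hone : ContKernel oneKernel := continuous_const
    have hS := hone.add (contKernel_sobMeanZero hα)
    have hle : Dominated (sobMeanZero (α + 1)) (oneKernel + sobMeanZero (α + 1)) :=
      .add_left posSemidef_oneKernel _
    have h1 := (ih.1.antideriv₂ (contKernel_cosSeries π hα) hS)
    have h2 := (ih.2.antideriv₂ (contKernel_sinSeries π hα) hS)
    rw [antideriv₂_sob hα] at h1 h2
    rw [antideriv₂_sinSeries pi_ne_zero hα hs] at h2
    exact ⟨(Dominated.smul_right (by positivity : 0 < (π ^ 2)⁻¹) _).trans (h2.trans hle),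
      .sinSeries_succ pi_ne_zero hα (dominated_oneKernel (by omega)) (h1.trans hle)⟩

/-! ### The kernels of the theorem and their comparison -/

theorem weight_natCast (α : ℕ) (γ : ℝ) (k : ℕ) :
    weight α γ ((k : ℤ) + 1) = γ * (1 / ((k : ℝ) + 1) ^ (2 * α)) := by
  rw [weight_natCast_succ, one_div, ← rpow_natCast, ← rpow_neg (by positivity)]
  push_cast
  ring_nf

theorem cosine_toMatrix (α : ℕ) (hα : 1 / 2 < (α : ℝ)) {γ : ℝ} (hγ : 0 < γ) :
    (cosine α hα γ hγ).toMatrix = oneKernel + (2 * γ) • cosSeries π α := by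
  ext x y
  simp only [cosine, cosFun, Matrix.of_apply, Matrix.add_apply, Matrix.smul_apply, smul_eq_mul,
    oneKernel, cosSeries, ← tsum_mul_left]
  congr 1
  refine tsum_congr fun k => ?_
  rw [weight_natCast]
  have h2 : √2 * √2 = 2 := mul_self_sqrt (by norm_num)
  linear_combination (γ * (1 / ((k : ℝ) + 1) ^ (2 * α)) * cos (π * ((k : ℝ) + 1) * x) *
    cos (π * ((k : ℝ) + 1) * y)) * h2

theorem weight_neg (α γ : ℝ) (h : ℤ) : weight α γ (-h) = weight α γ h := by
  simp [weight]

theorem kor_toMatrix {α : ℕ} (hα1 : 1 ≤ α) (hα : 1 / 2 < (α : ℝ)) {γ : ℝ} (hγ : 0 < γ) :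
    (kor α hα γ hγ).toMatrix =
      oneKernel + (2 * γ) • (cosSeries (2 * π) α + sinSeries (2 * π) α) := by
  ext x y
  -- Pairing `h` with `-h` counts `h = 0` twice; dropping the first paired term leaves `korFun - 1`.
  have h1 := (hasSum_nat_add_iff' 1).2 (hasSum_korFun hα hγ x y).nat_add_neg
  have h2 := ((summable_cosSeries (2 * π) hα1 x y).hasSum.add
    (summable_sinSeries (2 * π) hα1 x y).hasSum).mul_left (2 * γ)
  have h3 := h1.unique (h2.congr_fun fun k => by
    rw [weight_neg]
    push_cast
    rw [weight_natCast, mul_neg, neg_mul, cos_neg, mul_sub, cos_sub]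
    ring)
  simp only [Finset.sum_range_one, Nat.cast_zero, Int.cast_zero, neg_zero, mul_zero, zero_mul,
    cos_zero, mul_one, weight, if_true] at h3
  change korFun α γ x y = 1 + 2 * γ * (cosSeries (2 * π) α x y + sinSeries (2 * π) α x y)
  refine (eq_add_of_sub_eq' ?_).trans (congrArg _ h3)
  ring

theorem sob_toMatrix {α : ℕ} (hα : 1 ≤ α) {γ : ℝ} (hγ : 0 < γ) :
    (sob α hα γ hγ).toMatrix = oneKernel + γ • sobMeanZero α := by
  ext x y
  have h1 := cosSeries_add_sinSeries hα x y
  have h2 : ∑ τ ∈ Finset.Icc 1 α, bernoulliFun τ x * bernoulliFun τ y / (τ.factorial : ℝ) ^ 2 =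
      ∑ τ ∈ Finset.range α, bernoulliKernel (τ + 1) x y := by
    rw [Finset.range_eq_Ico, Finset.sum_Ico_add' (fun τ => bernoulliKernel τ x y)]
    refine Finset.sum_congr (by ext; simp) fun τ _ => ?_
    simp only [bernoulliKernel, Matrix.of_apply]
    field_simp
  change sobFun α γ x y = 1 + γ * (sobMeanZero α) x y
  rw [sobFun, h2, sobMeanZero, Matrix.add_apply, Matrix.smul_apply, Matrix.add_apply, h1,
    Matrix.sum_apply, smul_eq_mul, pow_succ]
  have hp : ((2 : ℝ) * π) ^ (2 * α) ≠ 0 := by positivity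
  field_simp
  ring

theorem korCos_toMatrix {α : ℝ} (hα : 1 / 2 < α) {γ : ℝ} (hγ : 0 < γ) :
    (korCos α hα γ hγ).toMatrix =
      (1 / 2 : ℝ) • ((kor α hα γ hγ).toMatrix + (cosine α hα γ hγ).toMatrix) := rfl

theorem dominated_kor_korCos {α : ℝ} (hα : 1 / 2 < α) {γ : ℝ} (hγ : 0 < γ) :
    Dominated (kor α hα γ hγ).toMatrix (korCos α hα γ hγ).toMatrix := by
  rw [korCos_toMatrix]
  exact (Dominated.add_right (cosine α hα γ hγ).posSemidef _).trans (.smul_right (by norm_num) _)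

theorem dominated_cosine_korCos {α : ℝ} (hα : 1 / 2 < α) {γ : ℝ} (hγ : 0 < γ) :
    Dominated (cosine α hα γ hγ).toMatrix (korCos α hα γ hγ).toMatrix := by
  rw [korCos_toMatrix]
  exact (Dominated.add_left (kor α hα γ hγ).posSemidef _).trans (.smul_right (by norm_num) _)

theorem Dominated.korCos {α : ℝ} {hα : 1 / 2 < α} {γ : ℝ} {hγ : 0 < γ}
    {B : Matrix (Set.Icc (0 : ℝ) 1) (Set.Icc (0 : ℝ) 1) ℝ}
    (h1 : Dominated (kor α hα γ hγ).toMatrix B) (h2 : Dominated (cosine α hα γ hγ).toMatrix B) :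
    Dominated (RKSpaces.korCos α hα γ hγ).toMatrix B := by
  rw [korCos_toMatrix]
  exact (h1.add h2).smul (by norm_num)

/-- Since the constant kernel is on both sides, the scale factors, and so the weights `γ`, do not
affect domination. -/
theorem Dominated.one_add_smul {A B : Matrix (Set.Icc (0 : ℝ) 1) (Set.Icc (0 : ℝ) 1) ℝ} {a b : ℝ}
    (ha : 0 ≤ a) (hb : 0 < b) (hB : B.PosSemidef) (h : Dominated A (oneKernel + B)) :
    Dominated (oneKernel + a • A) (oneKernel + b • B) := by
  have h1 : Dominated oneKernel (oneKernel + b • B) := .add_right (hB.smul hb.le) _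
  have h2 : Dominated B (oneKernel + b • B) :=
    (Dominated.smul_right hb B).trans (.add_left posSemidef_oneKernel _)
  exact h1.add ((h.trans (h1.add h2)).smul ha)

theorem dominated_kor_sob {α : ℕ} (hα1 : 1 ≤ α) (hα : 1 / 2 < (α : ℝ)) {γ : ℝ} (hγ : 0 < γ) :
    Dominated (kor α hα γ hγ).toMatrix (sob α hα1 γ hγ).toMatrix := by
  rw [kor_toMatrix hα1, sob_toMatrix]
  exact .one_add_smul (by positivity) hγ (posSemidef_sobMeanZero hα1)
    ((dominated_periodic_sobMeanZero α).trans (.add_left posSemidef_oneKernel _))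

theorem dominated_cosine_sob {α : ℕ} (hα1 : 1 ≤ α) (hα : 1 / 2 < (α : ℝ)) {γ : ℝ} (hγ : 0 < γ) :
    Dominated (cosine α hα γ hγ).toMatrix (sob α hα1 γ hγ).toMatrix := by
  rw [cosine_toMatrix, sob_toMatrix]
  exact .one_add_smul (by positivity) hγ (posSemidef_sobMeanZero hα1)
    (dominated_halfPeriod_series hα1).1

theorem dominated_sob_cosine_one (h : 1 / 2 < ((1 : ℕ) : ℝ)) {γ : ℝ} (hγ : 0 < γ) :
    Dominated (sob 1 le_rfl γ hγ).toMatrix (cosine ((1 : ℕ) : ℝ) h γ hγ).toMatrix := by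
  rw [cosine_toMatrix, sob_toMatrix, sobMeanZero_one, smul_smul]
  exact .one_add_smul (by positivity) (by positivity) (posSemidef_cosSeries π le_rfl)
    (.add_left posSemidef_oneKernel _)

/-! ### Embeddings of the product spaces -/

section Products

variable {s : ℕ} (γ : Fin s → ℝ) (hγ : ∀ j, 0 < γ j)

theorem korS_contEmbedded_korCosS {α : ℝ} (hα : 1 / 2 < α) :
    (korS α hα γ hγ).ContEmbedded (korCosS α hα γ hγ) :=
  (RKernel.pi_dominated fun j => dominated_kor_korCos hα (hγ j)).contEmbedded

theorem cosineS_contEmbedded_korCosS {α : ℝ} (hα : 1 / 2 < α) :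
    (cosineS α hα γ hγ).ContEmbedded (korCosS α hα γ hγ) :=
  (RKernel.pi_dominated fun j => dominated_cosine_korCos hα (hγ j)).contEmbedded

theorem korS_contEmbedded_sobS {α : ℕ} (hα1 : 1 ≤ α) (hα : 1 / 2 < (α : ℝ)) :
    (korS α hα γ hγ).ContEmbedded (sobS α hα1 γ hγ) :=
  (RKernel.pi_dominated fun j => dominated_kor_sob hα1 hα (hγ j)).contEmbedded

theorem cosineS_contEmbedded_sobS {α : ℕ} (hα1 : 1 ≤ α) (hα : 1 / 2 < (α : ℝ)) :
    (cosineS α hα γ hγ).ContEmbedded (sobS α hα1 γ hγ) :=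
  (RKernel.pi_dominated fun j => dominated_cosine_sob hα1 hα (hγ j)).contEmbedded

theorem korCosS_contEmbedded_sobS {α : ℕ} (hα1 : 1 ≤ α) (hα : 1 / 2 < (α : ℝ)) :
    (korCosS α hα γ hγ).ContEmbedded (sobS α hα1 γ hγ) :=
  (RKernel.pi_dominated fun j =>
    (dominated_kor_sob hα1 hα (hγ j)).korCos (dominated_cosine_sob hα1 hα (hγ j))).contEmbedded

theorem sobS_one_contEmbedded_cosineS (h : 1 / 2 < ((1 : ℕ) : ℝ)) :
    (sobS 1 le_rfl γ hγ).ContEmbedded (cosineS ((1 : ℕ) : ℝ) h γ hγ) :=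
  (RKernel.pi_dominated fun j => dominated_sob_cosine_one h (hγ j)).contEmbedded

theorem sobS_one_contEmbedded_korCosS (h : 1 / 2 < ((1 : ℕ) : ℝ)) :
    (sobS 1 le_rfl γ hγ).ContEmbedded (korCosS ((1 : ℕ) : ℝ) h γ hγ) :=
  (RKernel.pi_dominated fun j =>
    (dominated_sob_cosine_one h (hγ j)).trans (dominated_cosine_korCos h (hγ j))).contEmbedded

theorem korCosS_one_contEmbedded_cosineS (h : 1 / 2 < ((1 : ℕ) : ℝ)) :
    (korCosS ((1 : ℕ) : ℝ) h γ hγ).ContEmbedded (cosineS ((1 : ℕ) : ℝ) h γ hγ) :=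
  (RKernel.pi_dominated fun j =>
    ((dominated_kor_sob le_rfl h (hγ j)).korCos (dominated_cosine_sob le_rfl h (hγ j))).trans
      (dominated_sob_cosine_one h (hγ j))).contEmbedded

end Products

end RKSpaces

end

theorem mainTheorem6 (s : ℕ) (hs : 1 ≤ s) (γ : Fin s → ℝ) (hγ : ∀ j, 0 < γ j) :
    -- smoothness `α = 1`
    ((RKSpaces.korS 1 RKSpaces.half_lt_one γ hγ).ContEmbedded (RKSpaces.sobS 1 le_rfl γ hγ) ∧
      (RKSpaces.sobS 1 le_rfl γ hγ).Equivalent (RKSpaces.cosineS 1 RKSpaces.half_lt_one γ hγ) ∧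
      (RKSpaces.cosineS 1 RKSpaces.half_lt_one γ hγ).Equivalent
        (RKSpaces.korCosS 1 RKSpaces.half_lt_one γ hγ) ∧
      (RKSpaces.sobS 1 le_rfl γ hγ).Equivalent (RKSpaces.korCosS 1 RKSpaces.half_lt_one γ hγ) ∧
      ¬ (RKSpaces.sobS 1 le_rfl γ hγ).functions ⊆
        (RKSpaces.korS 1 RKSpaces.half_lt_one γ hγ).functions ∧
      ¬ (RKSpaces.cosineS 1 RKSpaces.half_lt_one γ hγ).functions ⊆
        (RKSpaces.korS 1 RKSpaces.half_lt_one γ hγ).functions ∧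
      ¬ (RKSpaces.korCosS 1 RKSpaces.half_lt_one γ hγ).functions ⊆
        (RKSpaces.korS 1 RKSpaces.half_lt_one γ hγ).functions) ∧
    -- integer smoothness `α > 1`
    (∀ (α : ℕ) (hα : 1 < α),
      (RKSpaces.korS α (RKSpaces.half_lt_natCast hα) γ hγ).ContEmbedded
        (RKSpaces.korCosS α (RKSpaces.half_lt_natCast hα) γ hγ) ∧
      (RKSpaces.cosineS α (RKSpaces.half_lt_natCast hα) γ hγ).ContEmbedded
        (RKSpaces.korCosS α (RKSpaces.half_lt_natCast hα) γ hγ) ∧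
      (RKSpaces.korCosS α (RKSpaces.half_lt_natCast hα) γ hγ).ContEmbedded
        (RKSpaces.sobS α hα.le γ hγ)) ∧
    -- real smoothness `α > 1/2`
    (∀ (α : ℝ) (hα : 1 / 2 < α),
      ¬ (RKSpaces.cosineS α hα γ hγ).functions ⊆ (RKSpaces.korS α hα γ hγ).functions ∧
      ¬ (RKSpaces.korCosS α hα γ hγ).functions ⊆ (RKSpaces.korS α hα γ hγ).functions ∧
      (3 / 2 ≤ α →
        ¬ (RKSpaces.korCosS α hα γ hγ).functions ⊆ (RKSpaces.cosineS α hα γ hγ).functions ∧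
        ¬ (RKSpaces.korS α hα γ hγ).functions ⊆ (RKSpaces.cosineS α hα γ hγ).functions)) := by
  have h1 : (1 / 2 : ℝ) < ((1 : ℕ) : ℝ) := by norm_num
  have e1 : ((1 : ℕ) : ℝ) = 1 := Nat.cast_one
  have ks := RKSpaces.korS_contEmbedded_sobS γ hγ le_rfl h1
  have cs := RKSpaces.cosineS_contEmbedded_sobS γ hγ le_rfl h1
  have qs := RKSpaces.korCosS_contEmbedded_sobS γ hγ le_rfl h1
  have sc := RKSpaces.sobS_one_contEmbedded_cosineS γ hγ h1
  have sq := RKSpaces.sobS_one_contEmbedded_korCosS γ hγ h1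
  have qc := RKSpaces.korCosS_one_contEmbedded_cosineS γ hγ h1
  -- The integer-smoothness results involve the cast `((1 : ℕ) : ℝ)`, whereas the statement has the
  -- real number `1`.
  simp only [e1] at ks cs qs sc sq qc
  have cq := RKSpaces.cosineS_contEmbedded_korCosS γ hγ RKSpaces.half_lt_one
  have ck := RKSpaces.cosineS_not_subset_korS γ hγ hs RKSpaces.half_lt_one
  refine ⟨⟨ks, ⟨sc, cs⟩, ⟨cq, qc⟩, ⟨sq, qs⟩, fun h => ck (cs.1.trans h), ck,
    fun h => ck (cq.1.trans h)⟩, fun α hα => ⟨RKSpaces.korS_contEmbedded_korCosS γ hγ _,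
    RKSpaces.cosineS_contEmbedded_korCosS γ hγ _,
    RKSpaces.korCosS_contEmbedded_sobS γ hγ hα.le _⟩, fun α hα => ?_⟩
  have ck := RKSpaces.cosineS_not_subset_korS γ hγ hs hα
  refine ⟨ck, fun h => ck ((RKSpaces.cosineS_contEmbedded_korCosS γ hγ hα).1.trans h), fun hα' => ?_⟩
  have kc := RKSpaces.korS_not_subset_cosineS γ hγ hs hα hα'
  exact ⟨fun h => kc ((RKSpaces.korS_contEmbedded_korCosS γ hγ hα).1.trans h), kc⟩
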